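/- Let $r\ge 1$ and let $A,R,S$ be real $r\times r$ matrices with $R$ symmetric positive definite, $S$ symmetric positive semi-definite and $AR=RA'$ (reversibility; $'$ denotes transposition), such that $[R^{1/2},AR^{1/2},\dots,A^{r-1}R^{1/2}]$ and $[S^{1/2},A'S^{1/2},\dots,(A')^{r-1}S^{1/2}]$ have rank $r$. Then there is a unique positive definite $Q_\infty$ with $A'Q_\infty+Q_\infty A-Q_\infty RQ_\infty+S=0$, and $A^2+RS$ has a unique real square root $(A^2+RS)^{1/2}$ all of whose eigenvalues are positive reals. Put $F=A-RQ_\infty$ and $$P^h_\infty=\int_0^\infty e^{sF}Re^{sF'}\,ds,\qquad \eta^h_\infty=\mathcal N(0,P^h_\infty),\qquad \Lambda^h=-(P^h_\infty)^{-1/2}(A^2+RS)^{1/2}(P^h_\infty)^{1/2}.$$ The integral converges, $P^h_\infty$ is positive definite and $\Lambda^h$ is symmetric. Let $-\lambda^h_1$ be the largest eigenvalue of $\Lambda^h$; one has $\lambda^h_1>0$. Let $$\mathcal K^h_t(f)(x)=\int f\,d\mathcal N\Big(e^{tF}x,\int_0^te^{sF}Re^{sF'}ds\Big),\qquad \mathcal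 L^hf(x)=\sum_{k,l}F_{k,l}\,x_l\,\partial_{x_k}f(x)+\tfrac12\sum_{k,l}R_{k,l}\,\partial_{x_k}\partial_{x_l}f(x)$$ be the transition semigroup and the generator of $dX^h_t=FX^h_t\,dt+B\,dW_t$, $BB'=R$. Write $\eta(f)=\int f\,d\eta$. For $f\in L_2(\eta^h_\infty)$ and $t\ge0$, $\mathcal K^h_t(f)$ is well defined $\eta^h_\infty$-almost everywhere and belongs to $L_2(\eta^h_\infty)$, and: (1) For all $t\ge0$ and all $f\in L_2(\eta^h_\infty)$, $$\|\mathcal K^h_t(f)-\eta^h_\infty(f)\|_{L_2(\eta^h_\infty)}\le e^{-\lambda^h_1t}\,\|f-\eta^h_\infty(f)\|_{L_2(\eta^h_\infty)}.$$ (2) The Poincaré inequality $$\lambda^h_1\,\|f-\eta^h_\infty(f)\|^2_{L_2(\eta^h_\infty)}\le-\eta^h_\infty\big(f\,\mathcal L^h(f)\big)$$ holds for every $C^2$ function $f\in L_2(\eta^h_\infty)$ such that $f\,\mathcal L^hf$ is $\eta^h_\infty$-integrable. It also holds for every $f$ in the domain of the $L_2(\eta^h_\infty)$-generator, that is, every $f\in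 L_2(\eta^h_\infty)$ for which $(\mathcal K^h_tf-f)/t$ converges in $L_2(\eta^h_\infty)$ as $t\downarrow0$, with $\mathcal L^hf$ denoting the limit. (3) The two properties are equivalent: for every $c\in\mathbb R$, (1) holds with $c$ in place of $\lambda^h_1$ (for all $f$ and $t$) if and only if (2) holds with $c$ in place of $\lambda^h_1$ on the above class of $C^2$ functions, and also if and only if (2) holds with $c$ in place of $\lambda^h_1$ on the domain of the $L_2(\eta^h_\infty)$-generator. -/

import Mathlib

open MeasureTheory ProbabilityTheory Filter Topology Set
open scoped Matrix MatrixOrder ENNReal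

namespace GroundState

/-- The state space `ℝ^r`. -/
abbrev State (r : ℕ) := EuclideanSpace ℝ (Fin r)

/-- The `r × r²` matrix `[B, A B, …, A^(r-1) B]`; the block index is the first component of the
column index. -/
def controllabilityMatrix {r : ℕ} (A B : Matrix (Fin r) (Fin r) ℝ) :
    Matrix (Fin r) (Fin r × Fin r) ℝ :=
  Matrix.of fun i p => (A ^ (p.1 : ℕ) * B) i p.2

/-- The pairs `(A, R^{1/2})` and `(A', S^{1/2})` are controllable (rank conditions). -/
def ControllabilityCondition {r : ℕ} (A R S : Matrix (Fin r) (Fin r) ℝ) : Prop :=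
  (controllabilityMatrix A (CFC.sqrt R)).rank = r ∧
    (controllabilityMatrix Aᵀ (CFC.sqrt S)).rank = r

/-- `Q` is a positive definite solution of `A' Q + Q A - Q R Q + S = 0`. -/
def IsPosRiccatiSolution {r : ℕ} (A R S Q : Matrix (Fin r) (Fin r) ℝ) : Prop :=
  Q.PosDef ∧ Aᵀ * Q + Q * A - Q * R * Q + S = 0

/-- `M` is a square root of the (not necessarily symmetric) matrix `N`, and all its complex
eigenvalues are positive real numbers. -/
def IsPosSqrt {r : ℕ} (N M : Matrix (Fin r) (Fin r) ℝ) : Prop :=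
  M * M = N ∧ ∀ z ∈ spectrum ℂ (M.map (algebraMap ℝ ℂ)), z.im = 0 ∧ 0 < z.re

/-- The integrand `e^{sF} R e^{sF'}`. -/
noncomputable def covIntegrand {r : ℕ} (F R : Matrix (Fin r) (Fin r) ℝ) (s : ℝ) :
    Matrix (Fin r) (Fin r) ℝ :=
  NormedSpace.exp (s • F) * R * NormedSpace.exp (s • Fᵀ)

/-- The covariance `∫_0^t e^{sF} R e^{sF'} ds` (entrywise integral). -/
noncomputable def transitionCov {r : ℕ} (F R : Matrix (Fin r) (Fin r) ℝ) (t : ℝ) :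
    Matrix (Fin r) (Fin r) ℝ :=
  Matrix.of fun i j => ∫ s in (0 : ℝ)..t, covIntegrand F R s i j

/-- The limiting covariance `∫_0^∞ e^{sF} R e^{sF'} ds` (entrywise integral). -/
noncomputable def limitCov {r : ℕ} (F R : Matrix (Fin r) (Fin r) ℝ) :
    Matrix (Fin r) (Fin r) ℝ :=
  Matrix.of fun i j => ∫ s in Ioi (0 : ℝ), covIntegrand F R s i j

/-- Transition probability at time `t`, from the state `x`, of the linear diffusion
`dX_t = F X_t dt + B dW_t` with `B B' = R`: the law of
`X_t = e^{tF} x + ∫_0^t e^{(t-s)F} B dW_s`. -/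
noncomputable def transition {r : ℕ} (F R : Matrix (Fin r) (Fin r) ℝ) (t : ℝ) (x : State r) :
    Measure (State r) :=
  multivariateGaussian (Matrix.toEuclideanCLM (𝕜 := ℝ) (NormedSpace.exp (t • F)) x)
    (transitionCov F R t)

/-- The semigroup `f ↦ (x ↦ ∫ f(y) K_t(x, dy))` of the linear diffusion. -/
noncomputable def semigroup {r : ℕ} (F R : Matrix (Fin r) (Fin r) ℝ) (t : ℝ) (f : State r → ℝ)
    (x : State r) : ℝ :=
  ∫ y, f y ∂(transition F R t x)

/-- The stationary law `N(0, ∫_0^∞ e^{sF} R e^{sF'} ds)`. -/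
noncomputable def stationary {r : ℕ} (F R : Matrix (Fin r) (Fin r) ℝ) : Measure (State r) :=
  multivariateGaussian 0 (limitCov F R)

/-- The partial derivative `∂_{x_k} f`. -/
noncomputable def partialDeriv {r : ℕ} (k : Fin r) (f : State r → ℝ) (x : State r) : ℝ :=
  fderiv ℝ f x (EuclideanSpace.single k 1)

/-- The differential operator `∑ F_{k,l} x_l ∂_k f + (1/2) ∑ R_{k,l} ∂_k ∂_l f`. -/
noncomputable def generator {r : ℕ} (F R : Matrix (Fin r) (Fin r) ℝ) (f : State r → ℝ)
    (x : State r) : ℝ :=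
  ∑ k, ∑ l, F k l * x l * partialDeriv k f x
    + (1 / 2) * ∑ k, ∑ l, R k l * partialDeriv k (partialDeriv l f) x

/-- `f` is in the domain of the generator of the semigroup on `L²(η)`, `η` the stationary law, and
`g` is its image: `(K_t f - f) / t → g` in `L²(η)` as `t → 0+`. -/
def IsL2Generator {r : ℕ} (F R : Matrix (Fin r) (Fin r) ℝ) (f g : State r → ℝ) : Prop :=
  MemLp f 2 (stationary F R) ∧ MemLp g 2 (stationary F R) ∧
    Tendsto (fun t : ℝ =>
      eLpNorm (fun x => (semigroup F R t f x - f x) / t - g x) 2 (stationary F R))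
      (𝓝[>] 0) (𝓝 0)

/-- Exponential decay to equilibrium in `L²(η)` with rate `c`. -/
def ExpDecay {r : ℕ} (F R : Matrix (Fin r) (Fin r) ℝ) (c : ℝ) : Prop :=
  ∀ f : State r → ℝ, MemLp f 2 (stationary F R) → ∀ t : ℝ, 0 ≤ t →
    eLpNorm (fun x => semigroup F R t f x - ∫ y, f y ∂(stationary F R)) 2 (stationary F R)
      ≤ ENNReal.ofReal (Real.exp (-c * t)) *
        eLpNorm (fun x => f x - ∫ y, f y ∂(stationary F R)) 2 (stationary F R)

/-- Poincaré inequality with constant `c` for the differential operator: all `C²` functions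
`f ∈ L²(η)` for which the Dirichlet energy `-η(f L f)` makes sense. -/
def Poincare {r : ℕ} (F R : Matrix (Fin r) (Fin r) ℝ) (c : ℝ) : Prop :=
  ∀ f : State r → ℝ, ContDiff ℝ 2 f → MemLp f 2 (stationary F R) →
    Integrable (fun x => f x * generator F R f x) (stationary F R) →
    c * ∫ x, (f x - ∫ y, f y ∂(stationary F R)) ^ 2 ∂(stationary F R)
      ≤ -∫ x, f x * generator F R f x ∂(stationary F R)

/-- Poincaré inequality with constant `c` on the whole domain of the generator on `L²(η)`. -/
def PoincareL2 {r : ℕ} (F R : Matrix (Fin r) (Fin r) ℝ) (c : ℝ) : Prop :=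
  ∀ f g : State r → ℝ, IsL2Generator F R f g →
    c * ∫ x, (f x - ∫ y, f y ∂(stationary F R)) ^ 2 ∂(stationary F R)
      ≤ -∫ x, f x * g x ∂(stationary F R)

/-- The matrix `Λ = -P^{-1/2} M P^{1/2}`. -/
noncomputable def spectralMatrix {r : ℕ} (P M : Matrix (Fin r) (Fin r) ℝ) :
    Matrix (Fin r) (Fin r) ℝ :=
  -((CFC.sqrt P)⁻¹ * M * CFC.sqrt P)

end GroundState

/-! Reversibility reduces the algebra to symmetric matrices. With B = R^{1/2}, the matrix a = B⁻¹AB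
is symmetric, and q = BQB, s = BSB turn the Riccati equation into aq + qa − q² + s = 0, that is (q −
a)² = a² + s. Its solution is q = a + N with N = (a² + s)^{1/2}: observability makes a + N positive
definite, and a Lyapunov identity forces q − a to be the positive root for every positive definite
solution q (`exists_riccati_of_isHermitian`). Then F = −BNB⁻¹, and an orthonormal eigenbasis of N
yields V with R = VV' and F = −V diag(n) V⁻¹, n > 0 (`exists_diagonalization`). Since F² = A² + RS,
the positive square root is −F, the spectrum of −Λ is the set of the n_k, and λ = min n. Every
covariance in play has the form V diag(d) V', so matrix inequalities between them become scalar
ones.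

The decay is proved on exponentials e_a(x) = exp⟨a, x⟩, which span a dense subspace of L²(η) and
which the semigroup maps to multiples of exponentials. With G = e^{tF} and P the stationary
covariance, the variances of a combination of exponentials and of its image are quadratic forms in
the same weights, with kernels exp(a'Pb) − 1 and exp(a'GPG'b) − 1. From GPG' ≤ e^{-2λt} P, the Schur
product theorem gives the inequality term by term in the exponential series (`sum_exp_sub_one_le`,
`norm_sq_sub_le_of_expLp`).

Both Poincaré inequalities come from this decay as t ↓ 0. On the L² domain one differentiates ⟨f,
K_t f⟩ at 0. For C² functions, the stationary mean square increment E(f(X_t) − f(X_0))² = 2(‖f‖² −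
⟨f, K_t f⟩), divided by t, tends to η(Γ(f,f)) when f is C¹ and Lipschitz. Gaussian integration by
parts with FP = −R/2 identifies ½Γ as the Dirichlet form of the generator, and cutoffs then remove
the growth restriction.

The linear function dual to the k-th eigendirection is an eigenfunction of rate n_k, so each of the
three properties with constant c forces c ≤ n_k. As each also holds for every c ≤ min n, all three
are equivalent to c ≤ λ. -/

namespace GroundState
open Matrix
open scoped RealInnerProductSpace

/-! ### Observability and the symmetric Riccati equation -/

/-- A pair `(A, √S)` satisfying the rank condition is observable. -/
lemma eq_zero_of_observable {r : ℕ} {A S : Matrix (Fin r) (Fin r) ℝ} (hS : S.PosSemidef)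
    (hrank : (controllabilityMatrix Aᵀ (CFC.sqrt S)).rank = r) {v : Fin r → ℝ}
    (hv : ∀ k : ℕ, S *ᵥ (A ^ k *ᵥ v) = 0) : v = 0 := by
  have hsq : ∀ w : Fin r → ℝ, S *ᵥ w = 0 → CFC.sqrt S *ᵥ w = 0 := by
    intro w hw
    have hH : (CFC.sqrt S)ᴴ = CFC.sqrt S := (CFC.sqrt_nonneg S).posSemidef.isHermitian
    rw [← dotProduct_star_self_eq_zero, star_mulVec, hH, ← dotProduct_mulVec,
      mulVec_mulVec, CFC.sqrt_mul_sqrt_self S hS.nonneg, hw, dotProduct_zero]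
  have hmul : (controllabilityMatrix Aᵀ (CFC.sqrt S))ᵀ *ᵥ v = 0 := by
    ext p
    have h1 := congrFun (hsq _ (hv p.1)) p.2
    have hT : (CFC.sqrt S)ᵀ = CFC.sqrt S := by
      simpa [conjTranspose_eq_transpose_of_trivial] using
        (CFC.sqrt_nonneg S).posSemidef.isHermitian.eq
    rw [mulVec_mulVec] at h1
    have h2 : CFC.sqrt S * A ^ (p.1 : ℕ) = (Aᵀ ^ (p.1 : ℕ) * CFC.sqrt S)ᵀ := by
      rw [transpose_mul, hT, ← transpose_pow, transpose_transpose]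
    rw [h2] at h1
    exact h1
  have hinj : Function.Injective ((controllabilityMatrix Aᵀ (CFC.sqrt S))ᵀ.mulVecLin) := by
    rw [← LinearMap.ker_eq_bot, ← Submodule.finrank_eq_zero]
    have h1 := LinearMap.finrank_range_add_finrank_ker
      ((controllabilityMatrix Aᵀ (CFC.sqrt S))ᵀ.mulVecLin)
    have h2 : Module.finrank ℝ
        (LinearMap.range ((controllabilityMatrix Aᵀ (CFC.sqrt S))ᵀ.mulVecLin)) = r := by
      exact (rank_transpose (controllabilityMatrix Aᵀ (CFC.sqrt S))).trans hrank
    rw [Module.finrank_fin_fun] at h1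
    omega
  exact hinj (by rw [mulVecLin_apply, hmul, map_zero])

lemma quadForm_eq_zero_of_posSemidef {r : ℕ} {S : Matrix (Fin r) (Fin r) ℝ} (hS : S.PosSemidef)
    {v : Fin r → ℝ} (h : v ⬝ᵥ S *ᵥ v = 0) : S *ᵥ v = 0 :=
  (hS.dotProduct_mulVec_zero_iff v).1 (by simpa using h)

lemma dotProduct_mulVec_of_isHermitian {r : ℕ} {a : Matrix (Fin r) (Fin r) ℝ}
    (ha : a.IsHermitian) (v w : Fin r → ℝ) : v ⬝ᵥ a *ᵥ w = (a *ᵥ v) ⬝ᵥ w := by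
  have : aᵀ = a := by simpa [conjTranspose_eq_transpose_of_trivial] using ha.eq
  rw [dotProduct_mulVec, ← mulVec_transpose, this]

/-- A symmetric matrix all of whose eigenvalues are positive is positive definite. -/
lemma posDef_of_eigenvector {r : ℕ} {T : Matrix (Fin r) (Fin r) ℝ} (hT : T.IsHermitian)
    (h : ∀ (μ : ℝ) (v : Fin r → ℝ), v ≠ 0 → T *ᵥ v = μ • v → 0 < μ) : T.PosDef := by
  rw [hT.posDef_iff_eigenvalues_pos]
  intro i
  refine h _ (hT.eigenvectorBasis i) ?_ (hT.mulVec_eigenvectorBasis i)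
  intro h0
  have := hT.eigenvectorBasis.orthonormal.ne_zero i
  exact this (by ext j; exact congrFun h0 j)

lemma dotProduct_self_pos {r : ℕ} {v : Fin r → ℝ} (hv : v ≠ 0) : 0 < v ⬝ᵥ v := by
  simpa using dotProduct_star_self_pos_iff.2 hv

/-- The Riccati equation `a q + q a - q² + s = 0` for symmetric `a` (unit diffusion). -/
lemma exists_riccati_of_isHermitian {r : ℕ} {a s : Matrix (Fin r) (Fin r) ℝ}
    (ha : a.IsHermitian) (hs : s.PosSemidef)
    (hobs : ∀ v : Fin r → ℝ, (∀ k : ℕ, s *ᵥ (a ^ k *ᵥ v) = 0) → v = 0) :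
    ∃ N : Matrix (Fin r) (Fin r) ℝ, N.PosDef ∧ N * N = a * a + s ∧ (a + N).PosDef ∧
      ∀ q : Matrix (Fin r) (Fin r) ℝ, q.PosDef → a * q + q * a - q * q + s = 0 → q = a + N := by
  -- Invariant form of observability: a property that is stable under a and implies s v = 0 holds
  -- for no nonzero vector.
  have hinv : ∀ p : (Fin r → ℝ) → Prop, (∀ v, p v → s *ᵥ v = 0 ∧ p (a *ᵥ v)) →
      ∀ v, p v → v = 0 := by
    intro p hp v hv
    refine hobs v fun k => ?_
    have : p (a ^ k *ᵥ v) := by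
      induction k with
      | zero => simpa using hv
      | succ k ih => rw [pow_succ', ← mulVec_mulVec]; exact (hp _ ih).2
    exact (hp _ this).1
  have haa : (a * a).PosSemidef := by
    have := posSemidef_conjTranspose_mul_self a
    rwa [ha.eq] at this
  have hH : (a * a + s).PosDef := by
    refine PosDef.of_dotProduct_mulVec_pos (haa.add hs).isHermitian fun v hv => ?_
    refine lt_of_le_of_ne ((haa.add hs).dotProduct_mulVec_nonneg v) fun h0 => hv ?_
    refine hinv (fun v => a *ᵥ v = 0 ∧ s *ᵥ v = 0) (fun w hw => ⟨hw.2, by simp [hw.1]⟩) v ?_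
    have h1 := haa.dotProduct_mulVec_nonneg v
    have h2 := hs.dotProduct_mulVec_nonneg v
    rw [add_mulVec, dotProduct_add] at h0
    have h3 : star v ⬝ᵥ (a * a) *ᵥ v = 0 := by linarith
    have h4 : star v ⬝ᵥ s *ᵥ v = 0 := by linarith
    refine ⟨?_, quadForm_eq_zero_of_posSemidef hs (by simpa using h4)⟩
    rw [← mulVec_mulVec, star_trivial, dotProduct_mulVec_of_isHermitian ha] at h3
    simpa using h3
  set N := CFC.sqrt (a * a + s) with hN
  have hNN : N * N = a * a + s := CFC.sqrt_mul_sqrt_self _ hH.posSemidef.nonneg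
  have hNp : N.PosDef := by
    rw [PosSemidef.posDef_iff_isUnit (CFC.sqrt_nonneg _).posSemidef]
    have := hH.isUnit
    rw [← hNN] at this
    exact isUnit_of_mul_isUnit_left this
  refine ⟨N, hNp, hNN, ?_, ?_⟩
  · have hTh : (a + N).IsHermitian := ha.add hNp.isHermitian
    -- The Riccati equation for T = a + N in Lyapunov form, with a = T − N. Paired with an
    -- eigenvector it reads 2μ v'Nv − μ² v'v = v'sv ≥ 0, which excludes μ < 0 because N is positive
    -- definite.
    have key : (a + N) * N + N * (a + N) - (a + N) * (a + N) = s := by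
      have : s = N * N - a * a := by rw [hNN]; abel
      rw [this]; noncomm_ring
    refine posDef_of_eigenvector hTh fun μ v hv hμ => ?_
    have hq : 2 * μ * (v ⬝ᵥ N *ᵥ v) - μ ^ 2 * (v ⬝ᵥ v) = v ⬝ᵥ s *ᵥ v := by
      rw [← key, sub_mulVec, add_mulVec, ← mulVec_mulVec, ← mulVec_mulVec, ← mulVec_mulVec,
        dotProduct_sub, dotProduct_add, dotProduct_mulVec_of_isHermitian hTh,
        dotProduct_mulVec_of_isHermitian hTh, hμ]
      simp only [mulVec_smul, smul_dotProduct, dotProduct_smul, smul_eq_mul]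
      ring
    have hvv := dotProduct_self_pos hv
    have hvN : 0 < v ⬝ᵥ N *ᵥ v := by simpa using hNp.dotProduct_mulVec_pos hv
    have hvs : 0 ≤ v ⬝ᵥ s *ᵥ v := by simpa using hs.dotProduct_mulVec_nonneg v
    rcases lt_trichotomy μ 0 with h | h | h
    · nlinarith [mul_pos (neg_pos.2 h) hvN, mul_nonneg (sq_nonneg μ) hvv.le]
    · exfalso
      -- The case μ = 0: the kernel of T lies in the kernel of s and is stable under a, since there
      -- s w = T N w and a w = −N w. Observability makes it trivial.
      subst h
      refine hv (hinv (fun w => (a + N) *ᵥ w = 0) (fun w hw => ?_) v (by simpa using hμ))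
      have h1 : s *ᵥ w = (a + N) *ᵥ (N *ᵥ w) := by
        rw [← key, sub_mulVec, add_mulVec, ← mulVec_mulVec, ← mulVec_mulVec, ← mulVec_mulVec, hw]
        simp
      have h2 : s *ᵥ w = 0 := quadForm_eq_zero_of_posSemidef hs (by
        rw [h1, dotProduct_mulVec_of_isHermitian hTh, hw, zero_dotProduct])
      refine ⟨h2, ?_⟩
      have h3 : a *ᵥ w = -(N *ᵥ w) := by
        rw [add_mulVec] at hw; exact eq_neg_of_add_eq_zero_left hw
      rw [h3, mulVec_neg, ← h1, h2, neg_zero]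
    · exact h
  · intro q hq hric
    have hYh : (q - a).IsHermitian := hq.isHermitian.sub ha
    have hYY : (q - a) * (q - a) = a * a + s := by
      have : s = q * q - a * q - q * a := by
        rw [← sub_eq_zero, ← hric]; abel
      rw [this]; noncomm_ring
    -- Lyapunov identity for Y = q − a. On an eigenvector it gives 2μ v'qv = |qv|² + v'sv > 0, so Y
    -- is positive definite and hence the unique positive root of a² + s.
    have key : (q - a) * q + q * (q - a) = q * q + s := by
      have : s = q * q - a * q - q * a := by
        rw [← sub_eq_zero, ← hric]; abel
      rw [this]; noncomm_ring
    have hYp : (q - a).PosDef := by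
      refine posDef_of_eigenvector hYh fun μ v hv hμ => ?_
      have hqv : 2 * μ * (v ⬝ᵥ q *ᵥ v) = (q *ᵥ v) ⬝ᵥ (q *ᵥ v) + v ⬝ᵥ s *ᵥ v := by
        rw [← dotProduct_mulVec_of_isHermitian hq.isHermitian, mulVec_mulVec, ← dotProduct_add,
          ← add_mulVec, ← key, add_mulVec, dotProduct_add, ← mulVec_mulVec, ← mulVec_mulVec,
          dotProduct_mulVec_of_isHermitian hYh, hμ]
        simp only [mulVec_smul, smul_dotProduct, dotProduct_smul, smul_eq_mul]
        ring
      have h1 : 0 < v ⬝ᵥ q *ᵥ v := by simpa using hq.dotProduct_mulVec_pos hv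
      have h2 : 0 ≤ v ⬝ᵥ s *ᵥ v := by simpa using hs.dotProduct_mulVec_nonneg v
      have h3 : 0 < (q *ᵥ v) ⬝ᵥ (q *ᵥ v) := dotProduct_self_pos fun h0 => by simp [h0] at h1
      by_contra hneg
      nlinarith
    have : N = q - a := by
      rw [hN, ← hYY]
      exact CFC.sqrt_mul_self _ hYp.posSemidef.nonneg
    rw [this]; abel

/-! ### Diagonalization of the closed-loop drift and the square root of A² + RS -/

/-- `V` diagonalizes the reversible pair `(F, R)`: `R = V V'` and `F = -V diag(n) V⁻¹`, `n > 0`. -/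
structure IsDiagonalization {r : ℕ} (F R V : Matrix (Fin r) (Fin r) ℝ) (n : Fin r → ℝ) :
    Prop where
  isUnit : IsUnit V
  pos : ∀ k, 0 < n k
  cov : R = V * Vᵀ
  drift : F = -(V * diagonal n * V⁻¹)

lemma conj_pow {r : ℕ} {A B : Matrix (Fin r) (Fin r) ℝ} (hB : IsUnit B) (k : ℕ) :
    (B⁻¹ * A * B) ^ k = B⁻¹ * A ^ k * B := by
  have h := B.mul_nonsing_inv ((isUnit_iff_isUnit_det B).1 hB)
  have h' := B.nonsing_inv_mul ((isUnit_iff_isUnit_det B).1 hB)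
  induction k with
  | zero => simp [h']
  | succ k ih =>
    rw [pow_succ, ih, pow_succ]
    calc B⁻¹ * A ^ k * B * (B⁻¹ * A * B) = B⁻¹ * A ^ k * (B * B⁻¹) * A * B := by
          simp only [Matrix.mul_assoc]
      _ = _ := by rw [h, Matrix.mul_one]; simp only [Matrix.mul_assoc]

/-- Existence and uniqueness for the Riccati equation of a reversible model, together with the
diagonalization of the closed loop drift. -/
lemma exists_diagonalization {r : ℕ} {A R S : Matrix (Fin r) (Fin r) ℝ}
    (hR : R.PosDef) (hS : S.PosSemidef) (hctrl : ControllabilityCondition A R S)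
    (hrev : A * R = R * Aᵀ) :
    ∃ Q V n, IsPosRiccatiSolution A R S Q ∧ (∀ Q', IsPosRiccatiSolution A R S Q' → Q' = Q) ∧
      IsDiagonalization (A - R * Q) R V n ∧ (A - R * Q) * (A - R * Q) = A * A + R * S := by
  set B := CFC.sqrt R
  have hBB : B * B = R := CFC.sqrt_mul_sqrt_self _ hR.posSemidef.nonneg
  have hBp : B.PosSemidef := (CFC.sqrt_nonneg R).posSemidef
  have hBu : IsUnit B := by
    have := hR.isUnit
    rw [← hBB] at this
    exact isUnit_of_mul_isUnit_left this
  have hBT : Bᵀ = B := by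
    simpa [conjTranspose_eq_transpose_of_trivial] using hBp.isHermitian.eq
  have hBH : Bᴴ = B := hBp.isHermitian.eq
  have hr := B.mul_nonsing_inv ((isUnit_iff_isUnit_det B).1 hBu)
  have hl := B.nonsing_inv_mul ((isUnit_iff_isUnit_det B).1 hBu)
  have hiT : B⁻¹ᵀ = B⁻¹ := by rw [transpose_nonsing_inv, hBT]
  set a := B⁻¹ * A * B with ha
  set s := B * S * B with hs
  have hsp : s.PosSemidef := by
    have := hS.conjTranspose_mul_mul_same B
    rwa [hBH] at this
  have haH : a.IsHermitian := by
    have h1 : B⁻¹ * (A * R) * B⁻¹ = a := by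
      rw [← hBB, ha]
      calc B⁻¹ * (A * (B * B)) * B⁻¹ = B⁻¹ * A * B * (B * B⁻¹) := by simp only [Matrix.mul_assoc]
        _ = _ := by rw [hr, Matrix.mul_one]
    have h2 : (A * R)ᵀ = A * R := by
      have hRT : Rᵀ = R := by
        simpa [conjTranspose_eq_transpose_of_trivial] using hR.isHermitian.eq
      rw [transpose_mul, hRT, hrev]
    rw [IsHermitian, conjTranspose_eq_transpose_of_trivial, ← h1, transpose_mul, transpose_mul, h2,
      hiT]
    simp only [Matrix.mul_assoc]
  have hobs : ∀ v : Fin r → ℝ, (∀ k : ℕ, s *ᵥ (a ^ k *ᵥ v) = 0) → v = 0 := by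
    intro v hv
    have h1 : B *ᵥ v = 0 := by
      refine eq_zero_of_observable hS hctrl.2 fun k => ?_
      have h2 := congrArg (fun w => B⁻¹ *ᵥ w) (hv k)
      simp only [mulVec_zero, mulVec_mulVec] at h2 ⊢
      rw [ha, conj_pow hBu, hs] at h2
      convert h2 using 2
      calc S * (A ^ k * B) = (B⁻¹ * B) * S * (B * B⁻¹) * A ^ k * B := by
            rw [hr, hl]; simp [Matrix.mul_assoc]
        _ = _ := by simp only [Matrix.mul_assoc]
    have := congrArg (fun w => B⁻¹ *ᵥ w) h1
    simpa [mulVec_mulVec, hl] using this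
  obtain ⟨N, hNp, hNN, hqp, huniq⟩ := exists_riccati_of_isHermitian haH hsp hobs
  have hAa : A = B * a * B⁻¹ := by
    rw [ha]
    calc A = (B * B⁻¹) * A * (B * B⁻¹) := by rw [hr]; simp
      _ = _ := by simp only [Matrix.mul_assoc]
  have hATa : Aᵀ = B⁻¹ * a * B := by
    have : aᵀ = a := by simpa [conjTranspose_eq_transpose_of_trivial] using haH.eq
    rw [hAa, transpose_mul, transpose_mul, hBT, hiT, this]
    exact (Matrix.mul_assoc _ _ _).symm
  have hSs : S = B⁻¹ * s * B⁻¹ := by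
    rw [hs]
    calc S = (B⁻¹ * B) * S * (B * B⁻¹) := by rw [hr, hl]; simp
      _ = _ := by simp only [Matrix.mul_assoc]
  have hric : ∀ q, Aᵀ * (B⁻¹ * q * B⁻¹) + (B⁻¹ * q * B⁻¹) * A -
      (B⁻¹ * q * B⁻¹) * R * (B⁻¹ * q * B⁻¹) + S = B⁻¹ * (a * q + q * a - q * q + s) * B⁻¹ := by
    intro q
    have e1 : Aᵀ * (B⁻¹ * q * B⁻¹) = B⁻¹ * (a * q) * B⁻¹ := by
      rw [hATa]
      calc _ = B⁻¹ * a * (B * B⁻¹) * q * B⁻¹ := by simp only [Matrix.mul_assoc]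
        _ = _ := by rw [hr, Matrix.mul_one]; simp only [Matrix.mul_assoc]
    have e2 : (B⁻¹ * q * B⁻¹) * A = B⁻¹ * (q * a) * B⁻¹ := by
      rw [hAa]
      calc _ = B⁻¹ * q * (B⁻¹ * B) * a * B⁻¹ := by simp only [Matrix.mul_assoc]
        _ = _ := by rw [hl, Matrix.mul_one]; simp only [Matrix.mul_assoc]
    have e3 : (B⁻¹ * q * B⁻¹) * R * (B⁻¹ * q * B⁻¹) = B⁻¹ * (q * q) * B⁻¹ := by
      rw [← hBB]
      calc _ = B⁻¹ * q * (B⁻¹ * B) * (B * B⁻¹) * q * B⁻¹ := by simp only [Matrix.mul_assoc]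
        _ = _ := by rw [hl, hr, Matrix.mul_one, Matrix.mul_one]; simp only [Matrix.mul_assoc]
    rw [e1, e2, e3, hSs]
    noncomm_ring
  have hback : ∀ Q, Q = B⁻¹ * (B * Q * B) * B⁻¹ := by
    intro Q
    calc Q = (B⁻¹ * B) * Q * (B * B⁻¹) := by rw [hr, hl]; simp
      _ = _ := by simp only [Matrix.mul_assoc]
  have hcancel : ∀ X, B⁻¹ * X * B⁻¹ = 0 → X = 0 := by
    intro X hX
    calc X = (B * B⁻¹) * X * (B⁻¹ * B) := by rw [hr, hl]; simp
      _ = B * (B⁻¹ * X * B⁻¹) * B := by simp only [Matrix.mul_assoc]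
      _ = 0 := by rw [hX]; simp
  have hdrift : A - R * (B⁻¹ * (a + N) * B⁻¹) = -(B * N * B⁻¹) := by
    have : R * (B⁻¹ * (a + N) * B⁻¹) = B * (a + N) * B⁻¹ := by
      rw [← hBB]
      calc _ = B * (B * B⁻¹) * (a + N) * B⁻¹ := by simp only [Matrix.mul_assoc]
        _ = _ := by rw [hr, Matrix.mul_one]
    rw [this, hAa]; noncomm_ring
  have hNh := hNp.isHermitian
  set U : Matrix (Fin r) (Fin r) ℝ := (hNh.eigenvectorUnitary : Matrix (Fin r) (Fin r) ℝ) with hU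
  have hUU : U * Uᵀ = 1 := by
    have := Unitary.mul_star_self_of_mem hNh.eigenvectorUnitary.2
    rwa [star_eq_conjTranspose, conjTranspose_eq_transpose_of_trivial] at this
  have hUinv : U⁻¹ = Uᵀ := inv_eq_right_inv hUU
  have hNU : N = U * diagonal hNh.eigenvalues * Uᵀ := by
    have := hNh.spectral_theorem
    rw [Unitary.conjStarAlgAut_apply] at this
    simpa [star_eq_conjTranspose, conjTranspose_eq_transpose_of_trivial] using this
  -- Undoing Q ↦ BQB gives Q. With N = U diag(n) U' and U orthogonal, V = BU satisfies both VV' = B²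
  -- = R and −BNB⁻¹ = −V diag(n) V⁻¹.
  refine ⟨B⁻¹ * (a + N) * B⁻¹, B * U, hNh.eigenvalues, ⟨?_, ?_⟩, ?_, ⟨?_, ?_, ?_, ?_⟩, ?_⟩
  · have := hqp.conjTranspose_mul_mul_same (B := B⁻¹) (by
      intro v w hvw
      have := congrArg (fun w => B *ᵥ w) hvw
      simpa [mulVec_mulVec, hr] using this)
    rwa [conjTranspose_eq_transpose_of_trivial, hiT] at this
  · rw [hric]
    have : a * (a + N) + (a + N) * a - (a + N) * (a + N) + s = 0 := by
      have : s = N * N - a * a := by rw [hNN]; abel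
      rw [this]; noncomm_ring
    rw [this]; simp
  · intro Q hQ
    have h1 := hQ.2
    rw [hback Q, hric] at h1
    rw [← huniq (B * Q * B) ?_ (hcancel _ h1)]
    · exact hback Q
    · have := hQ.1.conjTranspose_mul_mul_same (B := B) (by
        intro v w hvw
        have := congrArg (fun w => B⁻¹ *ᵥ w) hvw
        simpa [mulVec_mulVec, hl] using this)
      rwa [hBH] at this
  · exact hBu.mul (IsUnit.of_mul_eq_one _ hUU)
  · exact fun k => hNp.eigenvalues_pos k
  · rw [transpose_mul, hBT, ← hBB]
    calc B * B = B * (U * Uᵀ) * B := by rw [hUU, Matrix.mul_one]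
      _ = _ := by simp only [Matrix.mul_assoc]
  · rw [hdrift, Matrix.mul_inv_rev, hUinv]
    conv_lhs => rw [hNU]
    simp only [Matrix.mul_assoc]
  · rw [hdrift]
    calc -(B * N * B⁻¹) * -(B * N * B⁻¹) = B * N * (B⁻¹ * B) * N * B⁻¹ := by
          simp only [Matrix.mul_assoc, neg_mul_neg]
      _ = B * (N * N) * B⁻¹ := by rw [hl, Matrix.mul_one]; simp only [Matrix.mul_assoc]
      _ = (B * a * (B⁻¹ * B) * a * B⁻¹) + (B * B) * (B⁻¹ * s * B⁻¹) := by
          rw [hNN, hl, Matrix.mul_one, Matrix.mul_add, Matrix.add_mul]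
          congr 1
          · simp only [Matrix.mul_assoc]
          · calc B * s * B⁻¹ = B * (B * B⁻¹) * s * B⁻¹ := by rw [hr, Matrix.mul_one]
              _ = _ := by simp only [Matrix.mul_assoc]
      _ = A * A + R * S := by
          rw [hBB, ← hSs]
          conv_rhs => rw [hAa]
          simp only [Matrix.mul_assoc]

namespace IsDiagonalization
variable {r : ℕ} {F R V : Matrix (Fin r) (Fin r) ℝ} {n : Fin r → ℝ}

lemma mul_inv (h : IsDiagonalization F R V n) : V * V⁻¹ = 1 :=
  V.mul_nonsing_inv ((isUnit_iff_isUnit_det V).1 h.isUnit)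

lemma inv_mul (h : IsDiagonalization F R V n) : V⁻¹ * V = 1 :=
  V.nonsing_inv_mul ((isUnit_iff_isUnit_det V).1 h.isUnit)

lemma neg_drift (h : IsDiagonalization F R V n) : -F = V * diagonal n * V⁻¹ := by
  rw [h.drift, neg_neg]

lemma neg_drift_mulVec_col (h : IsDiagonalization F R V n) (k : Fin r) :
    (-F) *ᵥ (V.col k) = n k • V.col k := by
  have h1 : V.col k = V *ᵥ Pi.single k 1 := by simp
  rw [h.neg_drift, h1, mulVec_mulVec, Matrix.mul_assoc, Matrix.mul_assoc, h.inv_mul, Matrix.mul_one,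
    ← mulVec_mulVec, ← mulVec_smul]
  congr 1
  ext i
  by_cases hi : i = k <;> simp [hi]

lemma spectrum_map_neg_drift (h : IsDiagonalization F R V n) {K : Type*} [Field K] [Algebra ℝ K] :
    spectrum K ((-F).map (algebraMap ℝ K)) = range fun k => algebraMap ℝ K (n k) := by
  set f : Matrix (Fin r) (Fin r) ℝ →+* Matrix (Fin r) (Fin r) K := (algebraMap ℝ K).mapMatrix
  let u : (Matrix (Fin r) (Fin r) K)ˣ :=
    ⟨f V, f V⁻¹, by rw [← map_mul, h.mul_inv, map_one], by rw [← map_mul, h.inv_mul, map_one]⟩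
  have : (-F).map (algebraMap ℝ K) = u * diagonal (fun k => algebraMap ℝ K (n k)) * u⁻¹ := by
    change f (-F) = f V * _ * f V⁻¹
    rw [h.neg_drift, map_mul, map_mul]
    congr 2
    simp [f, diagonal_map]
  rw [this, spectrum.units_conjugate, spectrum_diagonal]

lemma isPosSqrt (h : IsDiagonalization F R V n) : IsPosSqrt (F * F) (-F) := by
  refine ⟨by simp, fun z hz => ?_⟩
  rw [h.spectrum_map_neg_drift] at hz
  obtain ⟨k, rfl⟩ := hz
  simp [h.pos k]

/-- A Sylvester argument: M² = F² gives M(M + F) = (M + F)F. Hence M + F sends an eigenvector of −F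
for n_k either to 0 or to an eigenvector of M for −n_k; the latter is excluded by the positive
spectrum of M, and the columns of V form a basis. -/
lemma eq_neg_drift_of_isPosSqrt (h : IsDiagonalization F R V n)
    {M : Matrix (Fin r) (Fin r) ℝ} (hM : IsPosSqrt (F * F) M) : M = -F := by
  have hX : ∀ k, (M + F) *ᵥ V.col k = 0 := by
    intro k
    by_contra hne
    have e1 : M *ᵥ ((M + F) *ᵥ V.col k) = (-n k) • ((M + F) *ᵥ V.col k) := by
      have : M * (M + F) = -((M + F) * (-F)) := by rw [Matrix.mul_add, hM.1]; noncomm_ring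
      rw [mulVec_mulVec, this, neg_mulVec, ← mulVec_mulVec, h.neg_drift_mulVec_col, mulVec_smul,
        neg_smul]
    have e2 : algebraMap ℝ ℂ (-n k) ∈ spectrum ℂ (M.map (algebraMap ℝ ℂ)) := by
      rw [← spectrum_toLin', ← Module.End.hasEigenvalue_iff_mem_spectrum]
      refine Module.End.hasEigenvalue_of_hasEigenvector
        (x := fun i => algebraMap ℝ ℂ (((M + F) *ᵥ V.col k) i)) ⟨?_, ?_⟩
      · rw [Module.End.mem_eigenspace_iff]
        ext i
        have := congrArg (algebraMap ℝ ℂ) (congrFun e1 i)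
        simpa [mulVec, dotProduct] using this
      · intro h0
        exact hne (by ext i; simpa using congrFun h0 i)
    have := (hM.2 _ e2).2
    have := h.pos k
    simp at *
    linarith
  have h0 : (M + F) * V = 0 := by
    ext i k
    exact congrFun (hX k) i
  have : M + F = 0 := by
    calc M + F = (M + F) * V * V⁻¹ := by rw [Matrix.mul_assoc, h.mul_inv, Matrix.mul_one]
      _ = 0 := by rw [h0, Matrix.zero_mul]
  exact eq_neg_of_add_eq_zero_left this

end IsDiagonalization

/-! ### Covariances in the eigenbasis -/

lemma mul_diagonal_mul_transpose_apply {r : ℕ} (V : Matrix (Fin r) (Fin r) ℝ) (d : Fin r → ℝ)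
    (i j : Fin r) : (V * diagonal d * Vᵀ) i j = ∑ k, V i k * V j k * d k := by
  rw [mul_apply]
  refine Finset.sum_congr rfl fun k _ => ?_
  rw [mul_diagonal, transpose_apply]
  ring

namespace IsDiagonalization
variable {r : ℕ} {F R V : Matrix (Fin r) (Fin r) ℝ} {n : Fin r → ℝ}

lemma transpose_mul_inv (h : IsDiagonalization F R V n) : Vᵀ * V⁻¹ᵀ = 1 := by
  rw [← transpose_mul, h.inv_mul, transpose_one]

lemma exp_smul_drift (h : IsDiagonalization F R V n) (t : ℝ) :
    NormedSpace.exp (t • F) = V * diagonal (fun k => Real.exp (-t * n k)) * V⁻¹ := by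
  have : t • F = V * diagonal (fun k => -t * n k) * V⁻¹ := by
    have h1 : diagonal (fun k => -t * n k) = (-t) • diagonal n := by
      rw [← diagonal_smul]; rfl
    rw [h.drift, h1]; simp
  rw [this, Matrix.exp_conj _ _ h.isUnit, Matrix.exp_diagonal]
  congr 3
  ext k
  rw [Pi.coe_exp, Real.exp_eq_exp_ℝ]

/-- The congruence by e^{tF} preserves the matrices V diag(d) V' and scales the entries of d. All
later identities and inequalities between covariances thereby become scalar. -/
lemma exp_mul_mul_exp (h : IsDiagonalization F R V n) (t : ℝ) (d : Fin r → ℝ) :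
    NormedSpace.exp (t • F) * (V * diagonal d * Vᵀ) * (NormedSpace.exp (t • F))ᵀ =
      V * diagonal (fun k => Real.exp (-2 * t * n k) * d k) * Vᵀ := by
  rw [h.exp_smul_drift]
  simp only [transpose_mul, diagonal_transpose]
  set E := diagonal (fun k => Real.exp (-t * n k))
  calc V * E * V⁻¹ * (V * diagonal d * Vᵀ) * (V⁻¹ᵀ * (E * Vᵀ))
      = V * E * (V⁻¹ * V) * diagonal d * (Vᵀ * V⁻¹ᵀ) * E * Vᵀ := by simp only [Matrix.mul_assoc]
    _ = V * (E * diagonal d * E) * Vᵀ := by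
        rw [h.inv_mul, h.transpose_mul_inv, Matrix.mul_one, Matrix.mul_one]
        simp only [Matrix.mul_assoc]
    _ = _ := by
        rw [diagonal_mul_diagonal, diagonal_mul_diagonal]
        congr 3
        ext k
        rw [show -2 * t * n k = -t * n k + -t * n k by ring, Real.exp_add]
        ring

lemma covIntegrand_eq (h : IsDiagonalization F R V n) (s : ℝ) :
    covIntegrand F R s = V * diagonal (fun k => Real.exp (-2 * s * n k)) * Vᵀ := by
  have h1 : R = V * Matrix.diagonal (fun _ => (1 : ℝ)) * Vᵀ := by
    rw [h.cov, diagonal_one, Matrix.mul_one]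
  rw [covIntegrand, ← transpose_smul, Matrix.exp_transpose]
  conv_lhs => rw [h1]
  rw [h.exp_mul_mul_exp]
  simp

lemma integrableOn_covIntegrand (h : IsDiagonalization F R V n) (i j : Fin r) :
    IntegrableOn (fun s => covIntegrand F R s i j) (Ioi 0) := by
  simp_rw [h.covIntegrand_eq, mul_diagonal_mul_transpose_apply]
  refine integrable_finsetSum _ fun k _ => Integrable.const_mul ?_ _
  have := integrableOn_exp_mul_Ioi (a := -2 * n k) (by linarith [h.pos k]) 0
  refine this.congr_fun (fun s _ => ?_) measurableSet_Ioi
  simp only []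
  congr 1; ring

lemma limitCov_eq (h : IsDiagonalization F R V n) :
    limitCov F R = V * diagonal (fun k => 1 / (2 * n k)) * Vᵀ := by
  ext i j
  simp only [limitCov, of_apply]
  simp_rw [h.covIntegrand_eq, mul_diagonal_mul_transpose_apply]
  have hint : ∀ k, IntegrableOn (fun s => Real.exp (-2 * s * n k)) (Ioi 0) := fun k => by
    have := integrableOn_exp_mul_Ioi (a := -2 * n k) (by linarith [h.pos k]) 0
    refine this.congr_fun (fun s _ => ?_) measurableSet_Ioi
    simp only []
    congr 1; ring
  rw [integral_finsetSum _ fun k _ => (hint k).const_mul _]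
  refine Finset.sum_congr rfl fun k _ => ?_
  rw [integral_const_mul]
  congr 1
  have := integral_exp_mul_Ioi (a := -2 * n k) (by linarith [h.pos k]) 0
  calc ∫ s in Ioi (0 : ℝ), Real.exp (-2 * s * n k)
      = ∫ s in Ioi (0 : ℝ), Real.exp (-2 * n k * s) := by
        congr 1; ext s; ring_nf
    _ = _ := by rw [this]; simp

lemma transitionCov_eq (h : IsDiagonalization F R V n) (t : ℝ) :
    transitionCov F R t =
      V * diagonal (fun k => (1 - Real.exp (-2 * t * n k)) / (2 * n k)) * Vᵀ := by
  ext i j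
  simp only [transitionCov, of_apply]
  simp_rw [h.covIntegrand_eq, mul_diagonal_mul_transpose_apply]
  rw [intervalIntegral.integral_finsetSum fun k _ =>
    Continuous.intervalIntegrable (by fun_prop) _ _]
  refine Finset.sum_congr rfl fun k _ => ?_
  rw [intervalIntegral.integral_const_mul]
  congr 1
  have hk := (h.pos k).ne'
  have hd : ∀ s ∈ uIcc 0 t, HasDerivAt (fun s => -Real.exp (-2 * s * n k) / (2 * n k))
      (Real.exp (-2 * s * n k)) s := by
    intro s _
    have h1 : HasDerivAt (fun s : ℝ => -2 * s * n k) (-2 * n k) s := by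
      simpa using ((hasDerivAt_id s).const_mul (-2)).mul_const (n k)
    have := (h1.exp.neg).div_const (2 * n k)
    convert! this using 1
    field_simp
  rw [intervalIntegral.integral_eq_sub_of_hasDerivAt hd
    (Continuous.intervalIntegrable (by fun_prop) _ _)]
  simp
  ring

lemma posDef_of_diagonal (h : IsDiagonalization F R V n) {d : Fin r → ℝ} (hd : ∀ k, 0 < d k) :
    (V * diagonal d * Vᵀ).PosDef := by
  have := (posDef_diagonal_iff.2 hd).mul_mul_conjTranspose_same (B := V) (by
    intro v w hvw
    have := congrArg (fun w => w ᵥ* V⁻¹) hvw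
    simpa [vecMul_vecMul, h.mul_inv] using this)
  rwa [conjTranspose_eq_transpose_of_trivial] at this

lemma posSemidef_of_diagonal {d : Fin r → ℝ} (hd : ∀ k, 0 ≤ d k) :
    (V * diagonal d * Vᵀ).PosSemidef := by
  have := (posSemidef_diagonal_iff.2 hd).mul_mul_conjTranspose_same V
  rwa [conjTranspose_eq_transpose_of_trivial] at this

lemma posDef_limitCov (h : IsDiagonalization F R V n) : (limitCov F R).PosDef := by
  rw [h.limitCov_eq]
  exact h.posDef_of_diagonal fun k => by have := h.pos k; positivity

lemma posSemidef_transitionCov (h : IsDiagonalization F R V n) {t : ℝ} (ht : 0 ≤ t) :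
    (transitionCov F R t).PosSemidef := by
  rw [h.transitionCov_eq]
  refine posSemidef_of_diagonal fun k => ?_
  have := h.pos k
  have h1 : Real.exp (-2 * t * n k) ≤ 1 := Real.exp_le_one_iff.2 (by nlinarith [mul_nonneg ht this.le])
  exact div_nonneg (by linarith) (by linarith)

/-- The stationary covariance is preserved by the dynamics. -/
lemma exp_mul_limitCov_mul_exp_add (h : IsDiagonalization F R V n) (t : ℝ) :
    NormedSpace.exp (t • F) * limitCov F R * (NormedSpace.exp (t • F))ᵀ + transitionCov F R t =
      limitCov F R := by
  rw [h.limitCov_eq, h.exp_mul_mul_exp, h.transitionCov_eq, ← Matrix.add_mul, ← Matrix.mul_add,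
    diagonal_add]
  congr 3
  ext k
  ring

lemma posSemidef_exp_mul_limitCov_mul_exp (h : IsDiagonalization F R V n) (t : ℝ) :
    (NormedSpace.exp (t • F) * limitCov F R * (NormedSpace.exp (t • F))ᵀ).PosSemidef := by
  rw [h.limitCov_eq, h.exp_mul_mul_exp]
  exact posSemidef_of_diagonal fun k => by have := h.pos k; positivity

/-- Contraction of the covariance at the rate of the slowest mode. -/
lemma posSemidef_contraction (h : IsDiagonalization F R V n) {lam t : ℝ} (ht : 0 ≤ t)
    (hlam : ∀ k, lam ≤ n k) :
    (Real.exp (-2 * lam * t) • limitCov F R -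
      NormedSpace.exp (t • F) * limitCov F R * (NormedSpace.exp (t • F))ᵀ).PosSemidef := by
  rw [h.limitCov_eq, h.exp_mul_mul_exp, ← Matrix.smul_mul, ← Matrix.mul_smul, ← diagonal_smul,
    ← Matrix.sub_mul, ← Matrix.mul_sub, diagonal_sub]
  refine posSemidef_of_diagonal fun k => ?_
  have := h.pos k
  have h1 : Real.exp (-2 * t * n k) ≤ Real.exp (-2 * lam * t) :=
    Real.exp_le_exp.2 (by nlinarith [mul_le_mul_of_nonneg_left (hlam k) ht])
  simp only [Pi.smul_apply, smul_eq_mul]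
  rw [← sub_mul]
  exact mul_nonneg (by linarith) (by positivity)

/-- Detailed balance: the Lyapunov equation FP + PF' + R = 0 splits into two equal halves. This
yields both the symmetry of Λ and the Dirichlet form of the generator. -/
lemma drift_mul_limitCov (h : IsDiagonalization F R V n) :
    F * limitCov F R = -((1 / 2 : ℝ) • R) := by
  have h1 : diagonal n * diagonal (fun k => 1 / (2 * n k)) =
      (1 / 2 : ℝ) • (1 : Matrix (Fin r) (Fin r) ℝ) := by
    rw [diagonal_mul_diagonal, ← diagonal_one, ← diagonal_smul]
    congr 1
    ext k
    have := (h.pos k).ne'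
    simp
    field_simp
  rw [h.limitCov_eq, h.drift]
  calc -(V * diagonal n * V⁻¹) * (V * diagonal (fun k => 1 / (2 * n k)) * Vᵀ)
      = -(V * diagonal n * (V⁻¹ * V) * diagonal (fun k => 1 / (2 * n k)) * Vᵀ) := by
        rw [Matrix.neg_mul]; simp only [Matrix.mul_assoc]
    _ = -(V * (diagonal n * diagonal (fun k => 1 / (2 * n k))) * Vᵀ) := by
        rw [h.inv_mul, Matrix.mul_one]; simp only [Matrix.mul_assoc]
    _ = _ := by rw [h1, h.cov]; simp

/-- Writing P^{1/2} = P P^{-1/2} and using FP = −R/2 gives Λ = −½ P^{-1/2} R P^{-1/2}. -/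
lemma isHermitian_spectralMatrix (h : IsDiagonalization F R V n) :
    (spectralMatrix (limitCov F R) (-F)).IsHermitian := by
  have hP := h.posDef_limitCov
  set P := limitCov F R
  set B := CFC.sqrt P with hBdef
  have hBB : B * B = P := CFC.sqrt_mul_sqrt_self _ hP.posSemidef.nonneg
  have hBu : IsUnit B := by
    have := hP.isUnit
    rw [← hBB] at this
    exact isUnit_of_mul_isUnit_left this
  have hBT : Bᵀ = B := by
    simpa [conjTranspose_eq_transpose_of_trivial] using
      (CFC.sqrt_nonneg P).posSemidef.isHermitian.eq
  have hr := B.mul_nonsing_inv ((isUnit_iff_isUnit_det B).1 hBu)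
  have hiT : B⁻¹ᵀ = B⁻¹ := by rw [transpose_nonsing_inv, hBT]
  have hRT : Rᵀ = R := by rw [h.cov]; simp
  have : spectralMatrix P (-F) = -((1 / 2 : ℝ) • (B⁻¹ * R * B⁻¹)) := by
    calc spectralMatrix P (-F) = B⁻¹ * F * B * (B * B⁻¹) := by
          rw [hr, spectralMatrix]; simp [hBdef]
      _ = B⁻¹ * (F * (B * B)) * B⁻¹ := by simp only [Matrix.mul_assoc]
      _ = _ := by rw [hBB, h.drift_mul_limitCov]; simp
  rw [this, IsHermitian, conjTranspose_eq_transpose_of_trivial]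
  simp only [transpose_neg, transpose_smul, transpose_mul, hiT, hRT, Matrix.mul_assoc]

/-- −Λ is similar to −F through P^{1/2}. -/
lemma setOf_neg_mem_spectrum_spectralMatrix (h : IsDiagonalization F R V n) :
    {l : ℝ | -l ∈ spectrum ℝ (spectralMatrix (limitCov F R) (-F))} = range n := by
  have hP := h.posDef_limitCov
  have hBB : CFC.sqrt (limitCov F R) * CFC.sqrt (limitCov F R) = limitCov F R :=
    CFC.sqrt_mul_sqrt_self _ hP.posSemidef.nonneg
  have hBu : IsUnit (CFC.sqrt (limitCov F R)) := by
    have := hP.isUnit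
    rw [← hBB] at this
    exact isUnit_of_mul_isUnit_left this
  have hdet := (isUnit_iff_isUnit_det _).1 hBu
  let u : (Matrix (Fin r) (Fin r) ℝ)ˣ :=
    ⟨CFC.sqrt (limitCov F R), (CFC.sqrt (limitCov F R))⁻¹, mul_nonsing_inv _ hdet,
      nonsing_inv_mul _ hdet⟩
  have : spectralMatrix (limitCov F R) (-F) = -((u⁻¹ : (Matrix (Fin r) (Fin r) ℝ)ˣ) * (-F) * u) :=
    rfl
  ext l
  rw [mem_ofPred_eq, this, ← spectrum.neg_eq, Set.neg_mem_neg, spectrum.units_conjugate']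
  have h2 := h.spectrum_map_neg_drift (K := ℝ)
  simp only [Algebra.algebraMap_self, RingHom.id_apply] at h2
  have h3 : (-F).map (RingHom.id ℝ) = -F := by ext; simp
  rw [h3] at h2
  rw [h2]

end IsDiagonalization

/-! ### Gaussian laws: random maps, invariance, exponential moments -/

/-- The noise law does not depend on the starting point, so the semigroup averages f over one random
affine map. Fubini on the product of state and noise then replaces kernel arguments. -/
lemma transition_eq_map {r : ℕ} (F R : Matrix (Fin r) (Fin r) ℝ) (t : ℝ) (x : State r) :
    transition F R t x = (multivariateGaussian 0 (transitionCov F R t)).map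
      (fun w => toEuclideanCLM (𝕜 := ℝ) (NormedSpace.exp (t • F)) x + w) := by
  rw [transition, multivariateGaussian, multivariateGaussian,
    Measure.map_map (by fun_prop) (by fun_prop)]
  simp [Function.comp_def]

lemma adjoint_toEuclideanCLM {r : ℕ} (G : Matrix (Fin r) (Fin r) ℝ) :
    (toEuclideanCLM (𝕜 := ℝ) G).adjoint = toEuclideanCLM (𝕜 := ℝ) Gᵀ := by
  rw [← conjTranspose_eq_transpose_of_trivial, ← star_eq_conjTranspose, map_star]
  rfl

lemma charFun_map_toEuclideanCLM {r : ℕ} (μ : Measure (State r)) (G : Matrix (Fin r) (Fin r) ℝ)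
    (a : State r) : charFun (μ.map (toEuclideanCLM (𝕜 := ℝ) G)) a =
      charFun μ (toEuclideanCLM (𝕜 := ℝ) Gᵀ a) := by
  rw [charFun_apply, charFun_apply, integral_map (by fun_prop) (by fun_prop)]
  congr 1
  ext x
  rw [← adjoint_toEuclideanCLM, ContinuousLinearMap.adjoint_inner_right]

/-- On characteristic functions the push-forward by G and the convolution add the quadratic forms of
GPG' and C, whose sum is that of P. -/
lemma measurePreserving_linear_add {r : ℕ} {G P C : Matrix (Fin r) (Fin r) ℝ}
    (hP : P.PosSemidef) (hC : C.PosSemidef) (h : G * P * Gᵀ + C = P) :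
    MeasurePreserving (fun p : State r × State r => toEuclideanCLM (𝕜 := ℝ) G p.1 + p.2)
      ((multivariateGaussian 0 P).prod (multivariateGaussian 0 C)) (multivariateGaussian 0 P) := by
  refine ⟨by fun_prop, ?_⟩
  apply Measure.ext_of_charFun
  ext a
  have h1 : (fun p : State r × State r => toEuclideanCLM (𝕜 := ℝ) G p.1 + p.2) =
      (fun p => p.1 + p.2) ∘ (Prod.map (toEuclideanCLM (𝕜 := ℝ) G) id) := rfl
  rw [h1, ← Measure.map_map (by fun_prop) (by fun_prop), ← Measure.map_prod_map _ _ (by fun_prop)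
    (by fun_prop), Measure.map_id]
  change charFun (Measure.conv _ _) a = _
  rw [charFun_conv]
  rw [charFun_map_toEuclideanCLM, charFun_multivariateGaussian hP, charFun_multivariateGaussian hP,
    charFun_multivariateGaussian hC, ← Complex.exp_add]
  congr 1
  have h3 : (a.ofLp ⬝ᵥ P *ᵥ a.ofLp : ℝ) =
      (toEuclideanCLM (𝕜 := ℝ) Gᵀ a).ofLp ⬝ᵥ P *ᵥ (toEuclideanCLM (𝕜 := ℝ) Gᵀ a).ofLp +
        a.ofLp ⬝ᵥ C *ᵥ a.ofLp := by
    conv_lhs => rw [← h]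
    rw [add_mulVec, dotProduct_add, ofLp_toEuclideanCLM, ← mulVec_mulVec, ← mulVec_mulVec,
      dotProduct_mulVec _ G, ← mulVec_transpose]
  rw [h3]
  simp
  ring

lemma map_inner_multivariateGaussian {r : ℕ} {P : Matrix (Fin r) (Fin r) ℝ} (hP : P.PosSemidef)
    (a : State r) : (multivariateGaussian 0 P).map (fun x => ⟪a, x⟫) =
      gaussianReal 0 (a.ofLp ⬝ᵥ P *ᵥ a.ofLp).toNNReal := by
  have h := IsGaussian.map_eq_gaussianReal (μ := multivariateGaussian 0 P) (innerSL ℝ a)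
  have h1 : (multivariateGaussian 0 P)[innerSL ℝ a] = 0 := by
    rw [IsGaussian.integral_dual, integral_id_multivariateGaussian, map_zero]
  have h2 : Var[innerSL ℝ a; multivariateGaussian 0 P] = a.ofLp ⬝ᵥ P *ᵥ a.ofLp := by
    rw [← covarianceBilin_multivariateGaussian (μ := 0) hP,
      covarianceBilin_self IsGaussian.memLp_two_id]
    rfl
  rw [h1, h2] at h
  exact h

lemma integrable_exp_inner {r : ℕ} {P : Matrix (Fin r) (Fin r) ℝ} (hP : P.PosSemidef)
    (a : State r) : Integrable (fun x => Real.exp ⟪a, x⟫) (multivariateGaussian 0 P) := by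
  have h := integrable_exp_mul_gaussianReal (μ := 0)
    (v := (a.ofLp ⬝ᵥ P *ᵥ a.ofLp).toNNReal) 1
  rw [← map_inner_multivariateGaussian hP a, integrable_map_measure (by fun_prop) (by fun_prop)] at h
  simpa [Function.comp_def] using h

lemma integral_exp_inner {r : ℕ} {P : Matrix (Fin r) (Fin r) ℝ} (hP : P.PosSemidef)
    (a : State r) : ∫ x, Real.exp ⟪a, x⟫ ∂(multivariateGaussian 0 P) =
      Real.exp ((a.ofLp ⬝ᵥ P *ᵥ a.ofLp) / 2) := by
  have h := mgf_gaussianReal (p := gaussianReal 0 (a.ofLp ⬝ᵥ P *ᵥ a.ofLp).toNNReal)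
    (X := id) Measure.map_id 1
  rw [← map_inner_multivariateGaussian hP a, mgf_id_map (by fun_prop)] at h
  have h0 : 0 ≤ a.ofLp ⬝ᵥ P *ᵥ a.ofLp := by simpa using hP.dotProduct_mulVec_nonneg a.ofLp
  simpa [mgf, Real.coe_toNNReal _ h0] using h

lemma integral_inner_multivariateGaussian {r : ℕ} (P : Matrix (Fin r) (Fin r) ℝ)
    (a : State r) : ∫ x, ⟪a, x⟫ ∂(multivariateGaussian 0 P) = 0 := by
  have := IsGaussian.integral_dual (μ := multivariateGaussian 0 P) (innerSL ℝ a)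
  rw [integral_id_multivariateGaussian, map_zero] at this
  exact this

lemma integral_sq_inner {r : ℕ} {P : Matrix (Fin r) (Fin r) ℝ} (hP : P.PosSemidef)
    (a : State r) : ∫ x, ⟪a, x⟫ ^ 2 ∂(multivariateGaussian 0 P) = a.ofLp ⬝ᵥ P *ᵥ a.ofLp := by
  rw [← covarianceBilin_multivariateGaussian (μ := 0) hP,
    covarianceBilin_self IsGaussian.memLp_two_id, variance_of_integral_eq_zero (by fun_prop)
    (integral_inner_multivariateGaussian P a)]

/-! ### Contraction of the semigroup on L² -/

section Markov
variable {X Y : Type*} [MeasurableSpace X] [MeasurableSpace Y] {η : Measure X} {ν : Measure Y}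
  [IsProbabilityMeasure η] [IsProbabilityMeasure ν] {T : X × Y → X} {f : X → ℝ}

/-- The L¹ norm of each section is at most its L² norm for the probability ν; integrating the
squares and using invariance under T gives the contraction. -/
lemma memLp_two_integral_and_eLpNorm_le (hT : MeasurePreserving T (η.prod ν) η)
    (hf : MemLp f 2 η) :
    (∀ᵐ x ∂η, Integrable (fun y => f (T (x, y))) ν) ∧
      MemLp (fun x => ∫ y, f (T (x, y)) ∂ν) 2 η ∧
      eLpNorm (fun x => ∫ y, f (T (x, y)) ∂ν) 2 η ≤ eLpNorm f 2 η := by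
  have hF : MemLp (fun p => f (T p)) 2 (η.prod ν) := hf.comp_measurePreserving hT
  have hm : AEStronglyMeasurable (fun x => ∫ y, f (T (x, y)) ∂ν) η :=
    hF.aestronglyMeasurable.integral_prod_right'
  have hle : eLpNorm (fun x => ∫ y, f (T (x, y)) ∂ν) 2 η ≤ eLpNorm f 2 η := by
    rw [← eLpNorm_comp_measurePreserving hf.aestronglyMeasurable hT,
      eLpNorm_eq_lintegral_rpow_enorm_toReal (by simp) (by simp),
      eLpNorm_eq_lintegral_rpow_enorm_toReal (by simp) (by simp),
      lintegral_prod (fun z => ‖(f ∘ T) z‖ₑ ^ ENNReal.toReal 2)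
        (hF.aestronglyMeasurable.enorm.pow_const _)]
    gcongr with x
    -- The comparison is made for every x, not almost every one; where the section is not measurable
    -- the Bochner integral is 0 by convention.
    by_cases hx : AEStronglyMeasurable (fun y => f (T (x, y))) ν
    · have h1 : ‖∫ y, f (T (x, y)) ∂ν‖ₑ ≤ eLpNorm (fun y => f (T (x, y))) 2 ν :=
        (enorm_integral_le_lintegral_enorm _).trans (by
          rw [← eLpNorm_one_eq_lintegral_enorm]
          exact eLpNorm_le_eLpNorm_of_exponent_le (by norm_num) hx)
      refine (ENNReal.rpow_le_rpow h1 (by simp)).trans ?_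
      rw [eLpNorm_eq_lintegral_rpow_enorm_toReal (by simp) (by simp), ← ENNReal.rpow_mul]
      simp
    · rw [integral_undef fun h => hx h.1]
      simp
  exact ⟨(hF.integrable (by norm_num)).prod_right_ae, ⟨hm, hle.trans_lt hf.2⟩, hle⟩

lemma integral_integral_measurePreserving (hT : MeasurePreserving T (η.prod ν) η)
    (hf : Integrable f η) : ∫ x, ∫ y, f (T (x, y)) ∂ν ∂η = ∫ x, f x ∂η := by
  have hF : Integrable (fun p => f (T p)) (η.prod ν) := hT.integrable_comp_of_integrable hf
  rw [← integral_prod _ hF]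
  have := integral_map (μ := η.prod ν) (φ := T) hT.measurable.aemeasurable (f := f)
    (by rw [hT.map_eq]; exact hf.1)
  rw [← this, hT.map_eq]

end Markov

namespace IsDiagonalization
variable {r : ℕ} {F R V : Matrix (Fin r) (Fin r) ℝ} {n : Fin r → ℝ}

lemma measurePreserving (h : IsDiagonalization F R V n) {t : ℝ} (ht : 0 ≤ t) :
    MeasurePreserving (fun p : State r × State r =>
        toEuclideanCLM (𝕜 := ℝ) (NormedSpace.exp (t • F)) p.1 + p.2)
      ((stationary F R).prod (multivariateGaussian 0 (transitionCov F R t))) (stationary F R) :=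
  measurePreserving_linear_add h.posDef_limitCov.posSemidef (h.posSemidef_transitionCov ht)
    (h.exp_mul_limitCov_mul_exp_add t)

end IsDiagonalization

instance {r : ℕ} (F R : Matrix (Fin r) (Fin r) ℝ) : IsProbabilityMeasure (stationary F R) := by
  unfold stationary; infer_instance

lemma measurableEmbedding_const_add {r : ℕ} (a : State r) :
    MeasurableEmbedding (fun w : State r => a + w) :=
  (MeasurableEquiv.addLeft a).measurableEmbedding

lemma semigroup_apply {r : ℕ} (F R : Matrix (Fin r) (Fin r) ℝ) (t : ℝ) (f : State r → ℝ)
    (x : State r) : semigroup F R t f x =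
      ∫ w, f (toEuclideanCLM (𝕜 := ℝ) (NormedSpace.exp (t • F)) x + w)
        ∂(multivariateGaussian 0 (transitionCov F R t)) := by
  rw [semigroup, transition_eq_map, (measurableEmbedding_const_add _).integral_map]

namespace IsDiagonalization
variable {r : ℕ} {F R V : Matrix (Fin r) (Fin r) ℝ} {n : Fin r → ℝ} {f : State r → ℝ}

lemma ae_integrable_transition (h : IsDiagonalization F R V n) {t : ℝ} (ht : 0 ≤ t)
    (hf : MemLp f 2 (stationary F R)) :
    ∀ᵐ x ∂(stationary F R), Integrable f (transition F R t x) := by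
  filter_upwards [(memLp_two_integral_and_eLpNorm_le (h.measurePreserving ht) hf).1] with x hx
  rw [transition_eq_map, (measurableEmbedding_const_add _).integrable_map_iff]
  exact hx

lemma memLp_semigroup (h : IsDiagonalization F R V n) {t : ℝ} (ht : 0 ≤ t)
    (hf : MemLp f 2 (stationary F R)) : MemLp (semigroup F R t f) 2 (stationary F R) := by
  simp_rw [funext (semigroup_apply F R t f)]
  exact (memLp_two_integral_and_eLpNorm_le (h.measurePreserving ht) hf).2.1

lemma eLpNorm_semigroup_le (h : IsDiagonalization F R V n) {t : ℝ} (ht : 0 ≤ t)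
    (hf : MemLp f 2 (stationary F R)) :
    eLpNorm (semigroup F R t f) 2 (stationary F R) ≤ eLpNorm f 2 (stationary F R) := by
  simp_rw [funext (semigroup_apply F R t f)]
  exact (memLp_two_integral_and_eLpNorm_le (h.measurePreserving ht) hf).2.2

lemma integral_semigroup (h : IsDiagonalization F R V n) {t : ℝ} (ht : 0 ≤ t)
    (hf : MemLp f 2 (stationary F R)) :
    ∫ x, semigroup F R t f x ∂(stationary F R) = ∫ x, f x ∂(stationary F R) := by
  simp_rw [funext (semigroup_apply F R t f)]
  exact integral_integral_measurePreserving (h.measurePreserving ht) (hf.integrable (by norm_num))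

lemma semigroup_sub_ae (h : IsDiagonalization F R V n) {t : ℝ} (ht : 0 ≤ t) {g : State r → ℝ}
    (hf : MemLp f 2 (stationary F R)) (hg : MemLp g 2 (stationary F R)) :
    semigroup F R t (f - g) =ᵐ[stationary F R] semigroup F R t f - semigroup F R t g := by
  filter_upwards [h.ae_integrable_transition ht hf, h.ae_integrable_transition ht hg] with x h1 h2
  simp only [semigroup, Pi.sub_apply]
  rw [integral_sub h1 h2]

end IsDiagonalization

/-! ### Schur products and exponential kernels -/

lemma posSemidef_map_pow {ι : Type*} [Fintype ι] {K : Matrix ι ι ℝ} (hK : K.PosSemidef) (n : ℕ) :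
    (K.map (· ^ n)).PosSemidef := by
  classical
  induction n with
  | zero =>
    have := posSemidef_vecMulVec_self_star (fun _ : ι => (1 : ℝ))
    convert! this using 1
    ext i j
    simp [vecMulVec]
  | succ n ih =>
    exact ih.hadamard hK

/-- Induction by αK^{∘(m+1)} − L^{∘(m+1)} = (αK^{∘m} − L^{∘m})∘K + L^{∘m}∘(K − L), where K − L = (αK
− L) + (1 − α)K ≥ 0. Powers start at 1: at power 0 the difference is (α − 1) times the all-ones
matrix. -/
lemma posSemidef_smul_map_pow_sub {ι : Type*} [Fintype ι] {K L : Matrix ι ι ℝ} {α : ℝ}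
    (hK : K.PosSemidef) (hL : L.PosSemidef) (h : (α • K - L).PosSemidef) (hα : α ≤ 1) (n : ℕ) :
    (α • K.map (· ^ (n + 1)) - L.map (· ^ (n + 1))).PosSemidef := by
  classical
  induction n with
  | zero =>
    convert! h using 1
    ext i j
    simp
  | succ n ih =>
    have hKL : (K - L).PosSemidef := by
      have := h.add (hK.smul (sub_nonneg.2 hα))
      convert! this using 1
      ext i j
      simp
      ring
    have := (ih.hadamard hK).add ((posSemidef_map_pow hL (n + 1)).hadamard hKL)
    convert! this using 1
    ext i j
    simp
    ring

/-- Comparison of exponential kernels (Schur product theorem). -/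
lemma sum_exp_sub_one_le {ι : Type*} [Fintype ι] {K L : Matrix ι ι ℝ} {α : ℝ}
    (hK : K.PosSemidef) (hL : L.PosSemidef) (h : (α • K - L).PosSemidef) (hα : α ≤ 1)
    (d : ι → ℝ) :
    ∑ i, ∑ j, d i * d j * (Real.exp (L i j) - 1) ≤
      α * ∑ i, ∑ j, d i * d j * (Real.exp (K i j) - 1) := by
  -- Subtracting 1 drops the constant term of the series, the one for which the comparison fails
  -- when α < 1. In the application it is the squared mean.
  have hexp : ∀ x : ℝ, HasSum (fun n : ℕ => x ^ (n + 1) / (n + 1).factorial) (Real.exp x - 1) := by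
    intro x
    have h1 : HasSum (fun n : ℕ => x ^ n / n.factorial) (Real.exp x) := by
      rw [Real.exp_eq_exp_ℝ]; exact NormedSpace.expSeries_div_hasSum_exp x
    simpa using (hasSum_nat_add_iff' 1).2 h1
  have hs : HasSum (fun n : ℕ => ∑ i, ∑ j, d i * d j *
      (α * (K i j ^ (n + 1) / (n + 1).factorial) - L i j ^ (n + 1) / (n + 1).factorial))
      (∑ i, ∑ j, d i * d j * (α * (Real.exp (K i j) - 1) - (Real.exp (L i j) - 1))) :=
    hasSum_sum fun i _ => hasSum_sum fun j _ =>
      (((hexp (K i j)).mul_left α).sub (hexp (L i j))).mul_left _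
  have h0 := hs.nonneg fun n => by
    have h1 := (posSemidef_smul_map_pow_sub hK hL h hα n).dotProduct_mulVec_nonneg d
    have h2 : ∑ i, ∑ j, d i * d j *
        (α * (K i j ^ (n + 1) / (n + 1).factorial) - L i j ^ (n + 1) / (n + 1).factorial) =
        (1 / ((n + 1).factorial : ℝ)) *
          (star d ⬝ᵥ (α • K.map (· ^ (n + 1)) - L.map (· ^ (n + 1))) *ᵥ d) := by
      simp only [dotProduct, mulVec, Finset.mul_sum, star_trivial]
      refine Finset.sum_congr rfl fun i _ => Finset.sum_congr rfl fun j _ => ?_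
      simp
      ring
    rw [h2]
    positivity
  rw [← sub_nonneg]
  convert! h0 using 1
  simp only [Finset.mul_sum, ← Finset.sum_sub_distrib]
  refine Finset.sum_congr rfl fun i _ => Finset.sum_congr rfl fun j _ => ?_
  ring

/-! ### Totality of the exponentials in L² of a Gaussian law -/

section Density
variable {r : ℕ} {P : Matrix (Fin r) (Fin r) ℝ}

lemma memLp_exp_inner (hP : P.PosSemidef) (a : State r) :
    MemLp (fun x => Real.exp ⟪a, x⟫) 2 (multivariateGaussian 0 P) := by
  rw [memLp_two_iff_integrable_sq (by fun_prop)]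
  refine (integrable_exp_inner hP ((2 : ℝ) • a)).congr (ae_of_all _ fun x => ?_)
  simp only [real_inner_smul_left]
  rw [← Real.exp_nat_mul]
  simp

/-- The positive and negative parts of f are densities of two finite measures with the same finite
Laplace transform everywhere. Analytic continuation along each line equates their characteristic
functions, so the measures and then the densities agree. -/
lemma ae_eq_zero_of_integral_mul_exp_eq_zero (hP : P.PosSemidef) {f : State r → ℝ}
    (hf : Measurable f) (hf2 : MemLp f 2 (multivariateGaussian 0 P))
    (h0 : ∀ a, ∫ x, f x * Real.exp ⟪a, x⟫ ∂(multivariateGaussian 0 P) = 0) :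
    f =ᵐ[multivariateGaussian 0 P] 0 := by
  set η := multivariateGaussian 0 P with hη
  have hint : ∀ {g : State r → ℝ}, MemLp g 2 η → ∀ a, Integrable (fun x => g x * Real.exp ⟪a, x⟫) η :=
    fun hg a => hg.integrable_mul (memLp_exp_inner hP a)
  let p : State r → NNReal := fun x => (f x).toNNReal
  let q : State r → NNReal := fun x => (-f x).toNNReal
  have hpm : Measurable p := hf.real_toNNReal
  have hqm : Measurable q := hf.neg.real_toNNReal
  have hp2 : MemLp (fun x => (p x : ℝ)) 2 η := hf2.pos_part
  have hq2 : MemLp (fun x => (q x : ℝ)) 2 η := hf2.neg_part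
  have hpq : ∀ x, f x = p x - q x := fun x => by
    simp only [p, q, Real.coe_toNNReal']
    exact (max_zero_sub_eq_self (f x)).symm
  have hfin : ∀ {g : State r → NNReal}, Measurable g → MemLp (fun x => (g x : ℝ)) 2 η →
      IsFiniteMeasure (η.withDensity fun x => g x) := fun hg hg2 =>
    isFiniteMeasure_withDensity (by
      have := (hg2.integrable (by norm_num)).2
      rw [HasFiniteIntegral] at this
      simpa using this.ne)
  have hexp : ∀ {g : State r → NNReal}, Measurable g → MemLp (fun x => (g x : ℝ)) 2 η → ∀ a,
      Integrable (fun x => Real.exp ⟪a, x⟫) (η.withDensity fun x => g x) := fun hg hg2 a => by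
    rw [integrable_withDensity_iff_integrable_smul hg]
    exact hint hg2 a
  have := hfin hpm hp2
  have := hfin hqm hq2
  have hmgf : ∀ a, ∫ x, Real.exp ⟪a, x⟫ ∂(η.withDensity fun x => p x) =
      ∫ x, Real.exp ⟪a, x⟫ ∂(η.withDensity fun x => q x) := by
    intro a
    rw [integral_withDensity_eq_integral_smul hpm, integral_withDensity_eq_integral_smul hqm,
      ← sub_eq_zero]
    simp only [NNReal.smul_def, smul_eq_mul]
    rw [← integral_sub (hint hp2 a) (hint hq2 a), ← h0 a]
    congr 1
    ext x
    rw [hpq x, sub_mul]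
  -- The Laplace transforms at 0 give equal masses; the continuation theorem asks that the two
  -- measures vanish simultaneously.
  have hmass : (η.withDensity fun x => p x) = 0 ↔ (η.withDensity fun x => q x) = 0 := by
    have h1 := hmgf 0
    simp only [inner_zero_left, Real.exp_zero, integral_const, smul_eq_mul, mul_one] at h1
    rw [← Measure.measure_univ_eq_zero, ← Measure.measure_univ_eq_zero,
      ← measureReal_eq_zero_iff, ← measureReal_eq_zero_iff, h1]
  have heq : (η.withDensity fun x => (p x : ℝ≥0∞)) = η.withDensity fun x => (q x : ℝ≥0∞) := by
    apply Measure.ext_of_charFun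
    ext a
    have hm : mgf (fun x : State r => ⟪x, a⟫) (η.withDensity fun x => p x) =
        mgf (fun x : State r => ⟪x, a⟫) (η.withDensity fun x => q x) := by
      ext t
      have := hmgf (t • a)
      simpa only [mgf, real_inner_smul_left, real_inner_comm a] using this
    have huniv : integrableExpSet (fun x : State r => ⟪x, a⟫) (η.withDensity fun x => p x) =
        univ := by
      ext t
      simp only [integrableExpSet, mem_ofPred_eq, mem_univ, iff_true]
      have := hexp hpm hp2 (t • a)
      simpa only [real_inner_smul_left, real_inner_comm a] using this
    -- The strip of analyticity is the whole plane, so the value at i, which is the characteristic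
    -- function, is available.
    have := eqOn_complexMGF_of_mgf' hm hmass (x := Complex.I) (by simp [huniv])
    simp only [complexMGF] at this
    rw [charFun_apply, charFun_apply]
    simpa only [mul_comm Complex.I] using this
  have hae := (withDensity_eq_iff (by fun_prop) (by fun_prop) (by
    have := (hp2.integrable (by norm_num)).2
    rw [HasFiniteIntegral] at this
    simpa using this.ne)).1 heq
  filter_upwards [hae] with x hx
  have hx' : p x = q x := by exact_mod_cast hx
  rw [hpq x, hx', sub_self]
  rfl

end Density

/-! ### Spectral gap on exponentials -/

section ExpLp
variable {r : ℕ} {P : Matrix (Fin r) (Fin r) ℝ}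

/-- The exponential `x ↦ exp ⟪a, x⟫` as an element of `L²(N(0, P))`. -/
noncomputable def expLp (hP : P.PosSemidef) (a : State r) : Lp ℝ 2 (multivariateGaussian 0 P) :=
  (memLp_exp_inner hP a).toLp

lemma inner_expLp_left (hP : P.PosSemidef) (a : State r) (f : Lp ℝ 2 (multivariateGaussian 0 P)) :
    ⟪expLp hP a, f⟫ = ∫ x, f x * Real.exp ⟪a, x⟫ ∂(multivariateGaussian 0 P) := by
  rw [L2.inner_def]
  refine integral_congr_ae ?_
  filter_upwards [(memLp_exp_inner hP a).coeFn_toLp] with x hx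
  simp only [expLp, hx]
  simp

lemma inner_expLp_expLp (hP : P.PosSemidef) (a b : State r) :
    ⟪expLp hP a, expLp hP b⟫ = Real.exp (((a + b).ofLp ⬝ᵥ P *ᵥ (a + b).ofLp) / 2) := by
  rw [inner_expLp_left, ← integral_exp_inner hP]
  refine integral_congr_ae ?_
  filter_upwards [(memLp_exp_inner hP b).coeFn_toLp] with x hx
  simp only [expLp, hx]
  rw [inner_add_left, Real.exp_add, mul_comm]

/-- A vector orthogonal to every exponential has vanishing Laplace transform, hence is zero. -/
lemma topologicalClosure_span_expLp (hP : P.PosSemidef) :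
    (Submodule.span ℝ (range (expLp hP))).topologicalClosure = ⊤ := by
  rw [Submodule.topologicalClosure_eq_top_iff, Submodule.eq_bot_iff]
  intro f hf
  rw [Submodule.mem_orthogonal] at hf
  rw [Lp.eq_zero_iff_ae_eq_zero]
  refine ae_eq_zero_of_integral_mul_exp_eq_zero hP (Lp.stronglyMeasurable f).measurable (Lp.memLp f)
    fun a => ?_
  rw [← inner_expLp_left hP]
  exact hf _ (Submodule.subset_span ⟨a, rfl⟩)

lemma dotProduct_mulVec_add_self (hP : P.PosSemidef) (a b : Fin r → ℝ) :
    (a + b) ⬝ᵥ P *ᵥ (a + b) = a ⬝ᵥ P *ᵥ a + b ⬝ᵥ P *ᵥ b + 2 * (a ⬝ᵥ P *ᵥ b) := by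
  have : b ⬝ᵥ P *ᵥ a = a ⬝ᵥ P *ᵥ b := by
    rw [dotProduct_mulVec_of_isHermitian hP.isHermitian, dotProduct_comm]
  simp only [add_dotProduct, mulVec_add, dotProduct_add, this]
  ring

/-- The Gram kernel of a finite family of vectors. -/
lemma posSemidef_gram {ι : Type*} [Fintype ι] (hP : P.PosSemidef) (a : ι → Fin r → ℝ) :
    (Matrix.of fun i j => a i ⬝ᵥ P *ᵥ a j).PosSemidef := by
  have := hP.conjTranspose_mul_mul_same (Matrix.of fun k i => a i k)
  convert! this using 1
  ext i j
  simp only [of_apply, mul_apply, conjTranspose_apply, star_trivial, dotProduct, mulVec,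
    Finset.mul_sum, Finset.sum_mul]
  rw [Finset.sum_comm]
  exact Finset.sum_congr rfl fun _ _ => Finset.sum_congr rfl fun _ _ => by ring

/-- The spectral gap inequality in `L²(N(0, P))` for an operator acting on exponentials like a
Gaussian transition `x ↦ N(G x, C)`, where `G P G' + C = P` and `G P G' ≤ α P`. -/
lemma norm_sq_sub_le_of_expLp {G C : Matrix (Fin r) (Fin r) ℝ} {α : ℝ} (hP : P.PosSemidef)
    (hGC : G * P * Gᵀ + C = P) (hG : (G * P * Gᵀ).PosSemidef)
    (hα : (α • P - G * P * Gᵀ).PosSemidef) (hα1 : α ≤ 1)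
    (T : Lp ℝ 2 (multivariateGaussian 0 P) →L[ℝ] Lp ℝ 2 (multivariateGaussian 0 P))
    (hT : ∀ a, T (expLp hP a) = Real.exp ((a.ofLp ⬝ᵥ C *ᵥ a.ofLp) / 2) •
      expLp hP (toEuclideanCLM (𝕜 := ℝ) Gᵀ a))
    (f : Lp ℝ 2 (multivariateGaussian 0 P)) :
    ‖T f‖ ^ 2 - ⟪expLp hP 0, f⟫ ^ 2 ≤ α * (‖f‖ ^ 2 - ⟪expLp hP 0, f⟫ ^ 2) := by
  -- Both sides are continuous in f, so it is enough to treat the dense span of the exponentials.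
  -- Pairing with the exponential of parameter 0 is the mean.
  have hcl : IsClosed {f : Lp ℝ 2 (multivariateGaussian 0 P) |
      ‖T f‖ ^ 2 - ⟪expLp hP 0, f⟫ ^ 2 ≤ α * (‖f‖ ^ 2 - ⟪expLp hP 0, f⟫ ^ 2)} :=
    isClosed_le (by fun_prop) (by fun_prop)
  have hsub : ((Submodule.span ℝ (range (expLp hP))).topologicalClosure : Set _) ⊆
      {f : Lp ℝ 2 (multivariateGaussian 0 P) |
      ‖T f‖ ^ 2 - ⟪expLp hP 0, f⟫ ^ 2 ≤ α * (‖f‖ ^ 2 - ⟪expLp hP 0, f⟫ ^ 2)} := by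
    rw [Submodule.topologicalClosure_coe]
    refine closure_minimal (fun f hf => ?_) hcl
    rw [SetLike.mem_coe, Finsupp.mem_span_range_iff_exists_finsupp] at hf
    obtain ⟨c, rfl⟩ := hf
    rw [mem_ofPred_eq, Finsupp.sum, ← Finset.sum_coe_sort]
    -- These weights absorb the diagonal factors exp(a'Pa/2) of the Gram matrix, leaving the kernel
    -- exp(a'Pb) and the mean ∑ d.
    set d : c.support → ℝ := fun a =>
      c a * Real.exp ((a.1.ofLp ⬝ᵥ P *ᵥ a.1.ofLp) / 2) with hd
    have key := sum_exp_sub_one_le (posSemidef_gram hP fun a : c.support => a.1.ofLp)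
      (posSemidef_gram hG fun a : c.support => a.1.ofLp)
      (by
        convert! posSemidef_gram hα fun a : c.support => a.1.ofLp using 1
        ext i j
        simp [sub_mulVec, dotProduct_sub, smul_mulVec]) hα1 d
    simp only [of_apply] at key
    have e0 : ⟪expLp hP 0, ∑ a : c.support, c a • expLp hP a.1⟫ = ∑ a, d a := by
      rw [inner_sum]
      refine Finset.sum_congr rfl fun a _ => ?_
      rw [real_inner_smul_right, inner_expLp_expLp, zero_add]
    have hsq : (∑ a, d a) ^ 2 = ∑ a, ∑ b, d a * d b := by
      rw [sq, Finset.sum_mul_sum]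
    have e1 : ‖∑ a : c.support, c a • expLp hP a.1‖ ^ 2 =
        ∑ a : c.support, ∑ b : c.support, d a * d b * Real.exp (a.1.ofLp ⬝ᵥ P *ᵥ b.1.ofLp) := by
      rw [← real_inner_self_eq_norm_sq, sum_inner]
      refine Finset.sum_congr rfl fun a _ => ?_
      rw [inner_sum]
      refine Finset.sum_congr rfl fun b _ => ?_
      rw [real_inner_smul_left, real_inner_smul_right, inner_expLp_expLp, WithLp.ofLp_add,
        dotProduct_mulVec_add_self hP, hd]
      simp only [add_div, Real.exp_add]
      rw [mul_div_cancel_left₀ _ two_ne_zero]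
      ring
    have e2 : ‖T (∑ a : c.support, c a • expLp hP a.1)‖ ^ 2 =
        ∑ a : c.support, ∑ b : c.support, d a * d b *
          Real.exp (a.1.ofLp ⬝ᵥ (G * P * Gᵀ) *ᵥ b.1.ofLp) := by
      have hq : ∀ v w : Fin r → ℝ, (Gᵀ *ᵥ v) ⬝ᵥ P *ᵥ (Gᵀ *ᵥ w) = v ⬝ᵥ (G * P * Gᵀ) *ᵥ w := by
        intro v w
        rw [← mulVec_mulVec, ← mulVec_mulVec, dotProduct_mulVec v G, ← mulVec_transpose]
      -- The factor exp(a'Ca/2) produced by T and the Gram factor exp(a'GPG'a/2) multiply to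
      -- exp(a'Pa/2), so the image of f carries the same weights d.
      have hsplit : ∀ v : Fin r → ℝ, v ⬝ᵥ P *ᵥ v = v ⬝ᵥ (G * P * Gᵀ) *ᵥ v + v ⬝ᵥ C *ᵥ v := by
        intro v
        conv_lhs => rw [← hGC]
        rw [add_mulVec, dotProduct_add]
      simp only [map_sum, map_smul, hT]
      rw [← real_inner_self_eq_norm_sq, sum_inner]
      refine Finset.sum_congr rfl fun a _ => ?_
      rw [inner_sum]
      refine Finset.sum_congr rfl fun b _ => ?_
      simp only [real_inner_smul_left, real_inner_smul_right]
      rw [inner_expLp_expLp, WithLp.ofLp_add, dotProduct_mulVec_add_self hP, hd]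
      simp only [ofLp_toEuclideanCLM, hq]
      rw [hsplit a.1.ofLp, hsplit b.1.ofLp]
      simp only [add_div, Real.exp_add]
      rw [mul_div_cancel_left₀ _ two_ne_zero]
      ring
    rw [e0, e1, e2, hsq]
    simp only [mul_sub, mul_one, Finset.sum_sub_distrib] at key ⊢
    exact key
  have := hsub (by rw [topologicalClosure_span_expLp]; trivial : f ∈ _)
  exact this

end ExpLp

/-! ### Exponential decay of the semigroup -/

namespace IsDiagonalization
variable {r : ℕ} {F R V : Matrix (Fin r) (Fin r) ℝ} {n : Fin r → ℝ} {f : State r → ℝ}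

/-- The semigroup as a bounded operator on `L²`. -/
lemma exists_semigroupLp (h : IsDiagonalization F R V n) {t : ℝ} (ht : 0 ≤ t) :
    ∃ T : Lp ℝ 2 (stationary F R) →L[ℝ] Lp ℝ 2 (stationary F R),
      ∀ (f : State r → ℝ) (hf : MemLp f 2 (stationary F R)),
        T hf.toLp = (h.memLp_semigroup ht hf).toLp := by
  -- The semigroup acts on pointwise functions. It descends to almost-everywhere classes because the
  -- contraction bound makes the image of a null function null.
  have hcongr : ∀ f g : State r → ℝ, MemLp f 2 (stationary F R) → MemLp g 2 (stationary F R) →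
      f =ᵐ[stationary F R] g →
      semigroup F R t f =ᵐ[stationary F R] semigroup F R t g := by
    intro f g hf hg hfg
    have h1 := h.eLpNorm_semigroup_le ht (hf.sub hg)
    have h2 : eLpNorm (f - g) 2 (stationary F R) = 0 := by
      rw [eLpNorm_eq_zero_iff (hf.sub hg).1 (by simp)]
      filter_upwards [hfg] with x hx
      simp [hx]
    rw [h2, nonpos_iff_eq_zero,
      eLpNorm_eq_zero_iff (h.memLp_semigroup ht (hf.sub hg)).1 (by simp)] at h1
    filter_upwards [h1, h.semigroup_sub_ae ht hf hg] with x hx hx'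
    rw [hx'] at hx
    exact sub_eq_zero.1 hx
  let L : Lp ℝ 2 (stationary F R) →ₗ[ℝ] Lp ℝ 2 (stationary F R) :=
    { toFun := fun f => (h.memLp_semigroup ht (Lp.memLp f)).toLp
      map_add' := fun f g => by
        rw [← MemLp.toLp_add, MemLp.toLp_eq_toLp_iff]
        refine (hcongr _ _ (Lp.memLp _) ((Lp.memLp f).add (Lp.memLp g))
          (Lp.coeFn_add f g)).trans ?_
        filter_upwards [h.ae_integrable_transition ht (Lp.memLp f),
          h.ae_integrable_transition ht (Lp.memLp g)] with x h1 h2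
        simp only [semigroup, Pi.add_apply]
        rw [integral_add h1 h2]
      map_smul' := fun c f => by
        rw [RingHom.id_apply, ← MemLp.toLp_const_smul, MemLp.toLp_eq_toLp_iff]
        refine (hcongr _ _ (Lp.memLp _) ((Lp.memLp f).const_smul c)
          (Lp.coeFn_smul c f)).trans (ae_of_all _ fun x => ?_)
        simp only [semigroup, Pi.smul_apply]
        rw [integral_smul] }
  refine ⟨L.mkContinuous 1 fun f => ?_, fun f hf => ?_⟩
  · change ‖(h.memLp_semigroup ht (Lp.memLp f)).toLp‖ ≤ _
    rw [one_mul, Lp.norm_toLp, Lp.norm_def]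
    exact ENNReal.toReal_mono (Lp.memLp f).2.ne (h.eLpNorm_semigroup_le ht (Lp.memLp f))
  · change (h.memLp_semigroup ht (Lp.memLp hf.toLp)).toLp = _
    rw [MemLp.toLp_eq_toLp_iff]
    exact hcongr _ _ (Lp.memLp _) hf hf.coeFn_toLp

lemma semigroup_exp (h : IsDiagonalization F R V n) {t : ℝ} (ht : 0 ≤ t) (a x : State r) :
    semigroup F R t (fun x => Real.exp ⟪a, x⟫) x =
      Real.exp ((a.ofLp ⬝ᵥ transitionCov F R t *ᵥ a.ofLp) / 2) *
        Real.exp ⟪toEuclideanCLM (𝕜 := ℝ) (NormedSpace.exp (t • F))ᵀ a, x⟫ := by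
  rw [semigroup_apply, ← adjoint_toEuclideanCLM, ContinuousLinearMap.adjoint_inner_left,
    ← integral_exp_inner (h.posSemidef_transitionCov ht), mul_comm, ← integral_const_mul]
  congr 1
  ext w
  rw [inner_add_right, Real.exp_add]

lemma norm_sq_eq_integral {f : State r → ℝ} {η : Measure (State r)} (hf : MemLp f 2 η) :
    ‖hf.toLp‖ ^ 2 = ∫ x, f x ^ 2 ∂η := by
  rw [← real_inner_self_eq_norm_sq, L2.inner_def]
  refine integral_congr_ae ?_
  filter_upwards [hf.coeFn_toLp] with x hx
  rw [hx]
  simp [sq]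

lemma integral_sub_mean_sq {f : State r → ℝ} {η : Measure (State r)} [IsProbabilityMeasure η]
    (hf : MemLp f 2 η) (m : ℝ) (hm : m = ∫ x, f x ∂η) :
    ∫ x, (f x - m) ^ 2 ∂η = ∫ x, f x ^ 2 ∂η - m ^ 2 := by
  have h1 := hf.integrable_sq
  have h2 := hf.integrable (by norm_num : (1 : ℝ≥0∞) ≤ 2)
  have : ∀ x, (f x - m) ^ 2 = (f x ^ 2 - 2 * m * f x) + m ^ 2 := fun x => by ring
  simp_rw [this]
  have h3 : Integrable (fun x => f x ^ 2 - 2 * m * f x) η := h1.sub (h2.const_mul _)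
  rw [integral_add h3 (integrable_const _), integral_sub h1 (h2.const_mul _), integral_const_mul,
    ← hm]
  simp
  ring

/-- The squared form of the decay: the gap inequality on L² with G = e^{tF} and α = e^{-2λt}, the
factor by which GPG' is dominated by P. -/
lemma integral_semigroup_sub_mean_sq_le (h : IsDiagonalization F R V n) {lam t : ℝ} (ht : 0 ≤ t)
    (hlam0 : 0 ≤ lam) (hlam : ∀ k, lam ≤ n k) (hf : MemLp f 2 (stationary F R)) :
    ∫ x, (semigroup F R t f x - ∫ y, f y ∂(stationary F R)) ^ 2 ∂(stationary F R) ≤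
      Real.exp (-2 * lam * t) *
        ∫ x, (f x - ∫ y, f y ∂(stationary F R)) ^ 2 ∂(stationary F R) := by
  have hP := h.posDef_limitCov.posSemidef
  rw [integral_sub_mean_sq hf _ rfl,
    integral_sub_mean_sq (h.memLp_semigroup ht hf) _ (h.integral_semigroup ht hf).symm]
  have hKf := h.memLp_semigroup ht hf
  obtain ⟨T, hT⟩ : ∃ T : Lp ℝ 2 (multivariateGaussian 0 (limitCov F R)) →L[ℝ]
      Lp ℝ 2 (multivariateGaussian 0 (limitCov F R)),
      ∀ (f : State r → ℝ) (hf : MemLp f 2 (multivariateGaussian 0 (limitCov F R)))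
        (hKf : MemLp (semigroup F R t f) 2 (multivariateGaussian 0 (limitCov F R))),
        T hf.toLp = hKf.toLp := by
    obtain ⟨T, hT⟩ := h.exists_semigroupLp ht
    exact ⟨T, fun f hf _ => hT f hf⟩
  unfold stationary at hf hKf ⊢
  have key := norm_sq_sub_le_of_expLp (G := NormedSpace.exp (t • F)) hP
    (h.exp_mul_limitCov_mul_exp_add t)
    (h.posSemidef_exp_mul_limitCov_mul_exp t) (h.posSemidef_contraction ht hlam)
    (Real.exp_le_one_iff.2 (by nlinarith [mul_nonneg hlam0 ht])) T (fun a => by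
      have hK : MemLp (semigroup F R t fun x => Real.exp ⟪a, x⟫) 2
          (multivariateGaussian 0 (limitCov F R)) := h.memLp_semigroup ht (memLp_exp_inner hP a)
      refine (hT _ (memLp_exp_inner hP a) hK).trans ?_
      rw [expLp, ← MemLp.toLp_const_smul, MemLp.toLp_eq_toLp_iff]
      exact ae_of_all _ fun x => h.semigroup_exp ht a x) hf.toLp
  have hmean : ⟪expLp hP 0, hf.toLp⟫ = ∫ x, f x ∂(multivariateGaussian 0 (limitCov F R)) := by
    rw [inner_expLp_left]
    refine integral_congr_ae ?_
    filter_upwards [hf.coeFn_toLp] with x hx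
    rw [hx]; simp
  rwa [hT _ _ hKf, norm_sq_eq_integral, norm_sq_eq_integral, hmean] at key

lemma eLpNorm_two_eq {g : State r → ℝ} {η : Measure (State r)} (hg : MemLp g 2 η) :
    eLpNorm g 2 η = ENNReal.ofReal (Real.sqrt (∫ x, g x ^ 2 ∂η)) := by
  rw [← norm_sq_eq_integral hg, Real.sqrt_sq (norm_nonneg _), Lp.norm_toLp,
    ENNReal.ofReal_toReal hg.2.ne]

lemma expDecay (h : IsDiagonalization F R V n) {lam : ℝ} (hlam0 : 0 ≤ lam)
    (hlam : ∀ k, lam ≤ n k) : ExpDecay F R lam := by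
  intro f hf t ht
  have h1 : MemLp (fun x => f x - ∫ y, f y ∂(stationary F R)) 2 (stationary F R) :=
    hf.sub (memLp_const _)
  have h2 : MemLp (fun x => semigroup F R t f x - ∫ y, f y ∂(stationary F R)) 2
      (stationary F R) := (h.memLp_semigroup ht hf).sub (memLp_const _)
  rw [eLpNorm_two_eq h2, eLpNorm_two_eq h1, ← ENNReal.ofReal_mul (Real.exp_nonneg _)]
  refine ENNReal.ofReal_le_ofReal (Real.sqrt_le_iff.2 ⟨by positivity, ?_⟩)
  rw [mul_pow, Real.sq_sqrt (by positivity), ← Real.exp_nat_mul]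
  refine (h.integral_semigroup_sub_mean_sq_le ht hlam0 hlam hf).trans (le_of_eq ?_)
  congr 2
  push_cast
  ring

end IsDiagonalization

/-! ### Poincaré inequality on the L² domain -/

lemma abs_integral_mul_le_eLpNorm {X : Type*} [MeasurableSpace X] {η : Measure X} {f u : X → ℝ}
    (hf : MemLp f 2 η) (hu : MemLp u 2 η) :
    |∫ x, f x * u x ∂η| ≤ (eLpNorm f 2 η).toReal * (eLpNorm u 2 η).toReal := by
  have h1 : ∫ x, f x * u x ∂η = ⟪hf.toLp, hu.toLp⟫ := by
    rw [L2.inner_def]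
    refine integral_congr_ae ?_
    filter_upwards [hf.coeFn_toLp, hu.coeFn_toLp] with x h1 h2
    rw [h1, h2]
    simp [mul_comm]
  rw [h1, ← Lp.norm_toLp f hf, ← Lp.norm_toLp u hu]
  exact abs_real_inner_le_norm _ _

lemma tendsto_slope_exp (a : ℝ) :
    Tendsto (fun t : ℝ => (Real.exp (-t * a) - 1) / t) (𝓝[>] 0) (𝓝 (-a)) := by
  have h1 : HasDerivAt (fun t : ℝ => Real.exp (-t * a)) (-a) 0 := by
    have := ((hasDerivAt_id (0 : ℝ)).neg.mul_const a).exp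
    simpa using this
  have := (hasDerivAt_iff_tendsto_slope.1 h1).mono_left
    (nhdsWithin_mono 0 fun x (hx : 0 < x) => hx.ne')
  refine this.congr fun t => ?_
  rw [slope_def_field]
  simp

namespace IsDiagonalization
variable {r : ℕ} {F R V : Matrix (Fin r) (Fin r) ℝ} {n : Fin r → ℝ} {f : State r → ℝ}

/-- Decay of correlations, as an upper bound whose two sides agree at t = 0. Its derivative there is
what both Poincaré inequalities use. -/
lemma integral_mul_semigroup_le (h : IsDiagonalization F R V n) {lam t : ℝ} (ht : 0 ≤ t)
    (hlam0 : 0 ≤ lam) (hlam : ∀ k, lam ≤ n k) (hf : MemLp f 2 (stationary F R)) :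
    ∫ x, f x * semigroup F R t f x ∂(stationary F R) ≤
      Real.exp (-lam * t) * ∫ x, (f x - ∫ y, f y ∂(stationary F R)) ^ 2 ∂(stationary F R)
        + (∫ y, f y ∂(stationary F R)) ^ 2 := by
  have hK := h.memLp_semigroup ht hf
  have hle := h.integral_semigroup_sub_mean_sq_le ht hlam0 hlam hf
  have hmK := h.integral_semigroup ht hf
  set η := stationary F R
  set g := semigroup F R t f
  set m := ∫ y, f y ∂η with hm
  set α := Real.exp (-lam * t) with hα
  have hα0 : 0 < α := Real.exp_pos _
  have hα2 : Real.exp (-2 * lam * t) = α * α := by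
    rw [hα, ← Real.exp_add]; congr 1; ring
  have hu : MemLp (fun x => f x - m) 2 η := hf.sub (memLp_const _)
  have hv : MemLp (fun x => g x - m) 2 η := hK.sub (memLp_const _)
  have h1 : ∫ x, (f x - m) * (g x - m) ∂η = ∫ x, f x * g x ∂η - m ^ 2 := by
    have hfg : Integrable (fun x => f x * g x) η := hf.integrable_mul hK
    have hf1 := hf.integrable (by norm_num : (1 : ℝ≥0∞) ≤ 2)
    have hg1 := hK.integrable (by norm_num : (1 : ℝ≥0∞) ≤ 2)
    have e : ∀ x, (f x - m) * (g x - m) = f x * g x - (m * g x + m * f x - m ^ 2) :=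
      fun x => by ring
    have hs : Integrable (fun x => m * g x + m * f x) η := (hg1.const_mul _).add (hf1.const_mul _)
    have hs' : Integrable (fun x => m * g x + m * f x - m ^ 2) η := hs.sub (integrable_const _)
    simp_rw [e]
    rw [integral_sub hfg hs', integral_sub hs (integrable_const _),
      integral_add (hg1.const_mul _) (hf1.const_mul _), integral_const_mul, integral_const_mul,
      hmK, ← hm]
    simp
    ring
  have h2 : ∫ x, (f x - m) * (g x - m) ∂η ≤
      ∫ x, (α / 2 * (f x - m) ^ 2 + (2 * α)⁻¹ * (g x - m) ^ 2) ∂η := by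
    refine integral_mono (hu.integrable_mul hv)
      ((hu.integrable_sq.const_mul _).add (hv.integrable_sq.const_mul _)) fun x => ?_
    -- Young's inequality with weight α = e^{-λt}, which balances the two terms since the variance
    -- of K_t f is at most α² times that of f.
    have : 0 ≤ (2 * α)⁻¹ * (α * (f x - m) - (g x - m)) ^ 2 := by positivity
    have e : (2 * α)⁻¹ * (α * (f x - m) - (g x - m)) ^ 2 =
      α / 2 * (f x - m) ^ 2 + (2 * α)⁻¹ * (g x - m) ^ 2 - (f x - m) * (g x - m) := by
      field_simp
      ring
    linarith
  rw [integral_add (hu.integrable_sq.const_mul _) (hv.integrable_sq.const_mul _),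
    integral_const_mul, integral_const_mul] at h2
  have h3 : (2 * α)⁻¹ * ∫ x, (g x - m) ^ 2 ∂η ≤ α / 2 * ∫ x, (f x - m) ^ 2 ∂η := by
    rw [hα2] at hle
    calc (2 * α)⁻¹ * ∫ x, (g x - m) ^ 2 ∂η
        ≤ (2 * α)⁻¹ * (α * α * ∫ x, (f x - m) ^ 2 ∂η) := by gcongr
      _ = _ := by field_simp
  linarith

/-- Divide the correlation bound by t after subtracting ‖f‖², and let t ↓ 0. Strong convergence of
the difference quotients passes to their pairing with f by Cauchy–Schwarz. -/
lemma poincareL2 (h : IsDiagonalization F R V n) {lam : ℝ} (hlam0 : 0 ≤ lam)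
    (hlam : ∀ k, lam ≤ n k) : PoincareL2 F R lam := by
  intro f g ⟨hf, hg, hlim⟩
  set η := stationary F R with hη
  have hu : ∀ t : ℝ, 0 < t → MemLp (fun x => (semigroup F R t f x - f x) / t) 2 η := by
    intro t ht
    have := ((h.memLp_semigroup ht.le hf).sub hf).const_mul t⁻¹
    refine this.ae_eq (ae_of_all _ fun x => ?_)
    simp [div_eq_inv_mul]
  have hconv : Tendsto (fun t : ℝ => ∫ x, f x * ((semigroup F R t f x - f x) / t) ∂η) (𝓝[>] 0)
      (𝓝 (∫ x, f x * g x ∂η)) := by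
    rw [tendsto_iff_dist_tendsto_zero]
    have hl := (ENNReal.tendsto_toReal ENNReal.zero_ne_top).comp hlim
    have hl2 := hl.const_mul (eLpNorm f 2 η).toReal
    rw [ENNReal.toReal_zero, mul_zero] at hl2
    refine squeeze_zero' (Eventually.of_forall fun _ => dist_nonneg) ?_ hl2
    filter_upwards [self_mem_nhdsWithin] with t ht
    have := abs_integral_mul_le_eLpNorm hf ((hu t ht).sub hg)
    have i1 : Integrable (fun x => f x * ((semigroup F R t f x - f x) / t)) η :=
      hf.integrable_mul (hu t ht)
    have i2 : Integrable (fun x => f x * g x) η := hf.integrable_mul hg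
    rw [Real.dist_eq, ← integral_sub i1 i2]
    simp only [Pi.sub_apply, mul_sub] at this
    exact this
  have hbound : ∀ᶠ t : ℝ in 𝓝[>] 0, ∫ x, f x * ((semigroup F R t f x - f x) / t) ∂η ≤
      ((Real.exp (-lam * t) - 1) / t) * ∫ x, (f x - ∫ y, f y ∂η) ^ 2 ∂η := by
    filter_upwards [self_mem_nhdsWithin] with t ht
    have ht' : 0 < t := ht
    have h1 := h.integral_mul_semigroup_le ht'.le hlam0 hlam hf
    have h2 := integral_sub_mean_sq hf _ rfl
    have h3 : ∫ x, f x * ((semigroup F R t f x - f x) / t) ∂η =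
        (∫ x, f x * semigroup F R t f x ∂η - ∫ x, f x ^ 2 ∂η) / t := by
      have i1 : Integrable (fun x => f x * semigroup F R t f x) η :=
        hf.integrable_mul (h.memLp_semigroup ht'.le hf)
      rw [← integral_sub i1 hf.integrable_sq, ← integral_div]
      congr 1
      ext x
      ring
    rw [h3, div_mul_eq_mul_div]
    gcongr
    rw [← hη] at h1
    linarith
  have hd : Tendsto (fun t : ℝ => (Real.exp (-lam * t) - 1) / t) (𝓝[>] 0) (𝓝 (-lam)) :=
    (tendsto_slope_exp lam).congr fun t => by rw [show -t * lam = -lam * t by ring]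
  have := le_of_tendsto_of_tendsto hconv (hd.mul_const _) hbound
  linarith

/-! ### Linear eigenfunctions and optimality of the rate -/

/-- The left eigenvector of `F` dual to the `k`-th column of `V`. -/
noncomputable def _root_.GroundState.leftEigenvector (V : Matrix (Fin r) (Fin r) ℝ) (k : Fin r) :
    State r := WithLp.toLp 2 (V⁻¹ᵀ *ᵥ Pi.single k 1)

lemma transpose_drift_mulVec (h : IsDiagonalization F R V n) (k : Fin r) :
    Fᵀ *ᵥ (leftEigenvector V k).ofLp = -n k • (leftEigenvector V k).ofLp := by
  have : Fᵀ = -(V⁻¹ᵀ * diagonal n * Vᵀ) := by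
    rw [h.drift]; simp [Matrix.mul_assoc]
  rw [leftEigenvector, this, mulVec_mulVec, Matrix.neg_mul, Matrix.mul_assoc,
    h.transpose_mul_inv, Matrix.mul_one, neg_mulVec, ← mulVec_mulVec, neg_smul, ← mulVec_smul]
  congr 2
  ext i
  by_cases hi : i = k <;> simp [hi]

lemma transpose_exp_apply (h : IsDiagonalization F R V n) (t : ℝ) (k : Fin r) :
    toEuclideanCLM (𝕜 := ℝ) (NormedSpace.exp (t • F))ᵀ (leftEigenvector V k) =
      Real.exp (-t * n k) • leftEigenvector V k := by
  have : (NormedSpace.exp (t • F))ᵀ = V⁻¹ᵀ * diagonal (fun k => Real.exp (-t * n k)) * Vᵀ := by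
    rw [h.exp_smul_drift]; simp [Matrix.mul_assoc]
  apply WithLp.ofLp_injective
  rw [ofLp_toEuclideanCLM, WithLp.ofLp_smul, leftEigenvector, this, mulVec_mulVec,
    Matrix.mul_assoc, h.transpose_mul_inv, Matrix.mul_one, ← mulVec_mulVec, ← mulVec_smul]
  congr 1
  ext i
  by_cases hi : i = k <;> simp [hi]

lemma leftEigenvector_ne_zero (h : IsDiagonalization F R V n) (k : Fin r) :
    (leftEigenvector V k).ofLp ≠ 0 := by
  intro h0
  have := congrArg (fun w => Vᵀ *ᵥ w) h0
  simp only [leftEigenvector, mulVec_mulVec, h.transpose_mul_inv, one_mulVec, mulVec_zero] at this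
  simpa using congrFun this k

lemma memLp_inner (F R : Matrix (Fin r) (Fin r) ℝ) (a : State r) :
    MemLp (fun x => ⟪a, x⟫) 2 (stationary F R) :=
  IsGaussian.memLp_dual (multivariateGaussian 0 (limitCov F R)) (innerSL ℝ a) 2 (by simp)

lemma integral_inner_stationary (F R : Matrix (Fin r) (Fin r) ℝ) (a : State r) :
    ∫ x, ⟪a, x⟫ ∂(stationary F R) = 0 :=
  integral_inner_multivariateGaussian _ _

lemma integral_sq_inner_pos (h : IsDiagonalization F R V n) (k : Fin r) :
    0 < ∫ x, ⟪leftEigenvector V k, x⟫ ^ 2 ∂(stationary F R) := by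
  rw [stationary, integral_sq_inner h.posDef_limitCov.posSemidef]
  simpa using h.posDef_limitCov.dotProduct_mulVec_pos (h.leftEigenvector_ne_zero k)

/-- The noise is centred and the left eigenvector diagonalizes the transposed flow, so this linear
function is a pure mode of rate n_k. -/
lemma semigroup_inner (h : IsDiagonalization F R V n) (t : ℝ) (k : Fin r) (x : State r) :
    semigroup F R t (fun x => ⟪leftEigenvector V k, x⟫) x =
      Real.exp (-t * n k) * ⟪leftEigenvector V k, x⟫ := by
  rw [semigroup_apply]
  simp_rw [inner_add_right]
  have hi : Integrable (fun w : State r => ⟪leftEigenvector V k, w⟫)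
      (multivariateGaussian 0 (transitionCov F R t)) :=
    IsGaussian.integrable_dual _ (innerSL ℝ (leftEigenvector V k))
  rw [integral_add (integrable_const _) hi, integral_inner_multivariateGaussian,
    ← ContinuousLinearMap.adjoint_inner_left, adjoint_toEuclideanCLM, h.transpose_exp_apply,
    real_inner_smul_left]
  simp

lemma partialDeriv_inner (a : State r) (k : Fin r) (x : State r) :
    partialDeriv k (fun x => ⟪a, x⟫) x = a.ofLp k := by
  rw [partialDeriv]
  change fderiv ℝ (innerSL ℝ a) x _ = _
  rw [ContinuousLinearMap.fderiv, innerSL_apply_apply, EuclideanSpace.inner_single_right]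
  simp

lemma generator_inner (h : IsDiagonalization F R V n) (k : Fin r) (x : State r) :
    generator F R (fun x => ⟪leftEigenvector V k, x⟫) x = -n k * ⟪leftEigenvector V k, x⟫ := by
  have h2 : ∀ i j, partialDeriv i (partialDeriv j fun x => ⟪leftEigenvector V k, x⟫) x = 0 := by
    intro i j
    rw [funext (partialDeriv_inner (leftEigenvector V k) j), partialDeriv]
    simp
  simp only [generator, h2, partialDeriv_inner, mul_zero, Finset.sum_const_zero, add_zero]
  rw [← real_inner_smul_left, PiLp.inner_apply, Finset.sum_comm]
  refine Finset.sum_congr rfl fun l _ => ?_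
  have := congrFun (h.transpose_drift_mulVec k) l
  simp only [mulVec, dotProduct, transpose_apply] at this
  rw [WithLp.ofLp_smul, ← this]
  simp only [RCLike.inner_apply, conj_trivial, Finset.mul_sum]
  exact Finset.sum_congr rfl fun i _ => by ring

/-- The linear mode, of positive variance, decays at rate exactly n_k; already t = 1 compares the
two rates. -/
lemma le_of_expDecay (h : IsDiagonalization F R V n) {c : ℝ} (hc : ExpDecay F R c) (k : Fin r) :
    c ≤ n k := by
  have hf := memLp_inner F R (leftEigenvector V k)
  have h1 := hc _ hf 1 zero_le_one
  have hpos := h.integral_sq_inner_pos k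
  rw [integral_inner_stationary] at h1
  simp only [sub_zero, h.semigroup_inner] at h1
  rw [eLpNorm_two_eq (hf.const_mul _), eLpNorm_two_eq hf,
    ← ENNReal.ofReal_mul (Real.exp_nonneg _)] at h1
  simp only [mul_pow] at h1
  rw [integral_const_mul, Real.sqrt_mul (by positivity), Real.sqrt_sq (Real.exp_nonneg _),
    ENNReal.ofReal_le_ofReal_iff (by positivity),
    mul_le_mul_iff_left₀ (Real.sqrt_pos.2 hpos), Real.exp_le_exp] at h1
  linarith

lemma le_of_poincare (h : IsDiagonalization F R V n) {c : ℝ} (hc : Poincare F R c) (k : Fin r) :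
    c ≤ n k := by
  have hf := memLp_inner F R (leftEigenvector V k)
  have hpos := h.integral_sq_inner_pos k
  have e : ∀ x, ⟪leftEigenvector V k, x⟫ * generator F R (fun x => ⟪leftEigenvector V k, x⟫) x =
      -n k * ⟪leftEigenvector V k, x⟫ ^ 2 := fun x => by rw [h.generator_inner]; ring
  have h1 := hc (fun x => ⟪leftEigenvector V k, x⟫) (innerSL ℝ (leftEigenvector V k)).contDiff hf
    (by simp_rw [e]; exact hf.integrable_sq.const_mul _)
  simp_rw [e] at h1
  rw [integral_inner_stationary, integral_const_mul] at h1
  simp only [sub_zero, neg_mul, neg_neg] at h1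
  exact le_of_mul_le_mul_right h1 hpos

/-- On a linear mode the difference quotient is a scalar multiple of the mode, so the L² convergence
is that of (e^{-t n_k} − 1)/t to −n_k. -/
lemma isL2Generator_inner (h : IsDiagonalization F R V n) (k : Fin r) :
    IsL2Generator F R (fun x => ⟪leftEigenvector V k, x⟫)
      (fun x => -n k * ⟪leftEigenvector V k, x⟫) := by
  have hf := memLp_inner F R (leftEigenvector V k)
  refine ⟨hf, hf.const_mul _, ?_⟩
  have hd : Tendsto (fun t : ℝ => (Real.exp (-t * n k) - 1) / t + n k) (𝓝[>] 0) (𝓝 0) := by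
    have := (tendsto_slope_exp (n k)).add_const (n k)
    rwa [neg_add_cancel] at this
  have e : ∀ t : ℝ, eLpNorm (fun x => (semigroup F R t (fun x => ⟪leftEigenvector V k, x⟫) x -
      ⟪leftEigenvector V k, x⟫) / t - -n k * ⟪leftEigenvector V k, x⟫) 2 (stationary F R) =
      ‖(Real.exp (-t * n k) - 1) / t + n k‖ₑ *
        eLpNorm (fun x => ⟪leftEigenvector V k, x⟫) 2 (stationary F R) := by
    intro t
    rw [← eLpNorm_const_smul]
    congr 1
    ext x
    simp only [h.semigroup_inner, Pi.smul_apply, smul_eq_mul]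
    ring
  simp_rw [e]
  have h1 : Tendsto (fun t : ℝ => ‖(Real.exp (-t * n k) - 1) / t + n k‖ₑ) (𝓝[>] 0) (𝓝 0) := by
    simpa using hd.enorm
  simpa using ENNReal.Tendsto.mul_const h1 (Or.inr hf.2.ne)

lemma le_of_poincareL2 (h : IsDiagonalization F R V n) {c : ℝ} (hc : PoincareL2 F R c)
    (k : Fin r) : c ≤ n k := by
  have hpos := h.integral_sq_inner_pos k
  have h1 := hc _ _ (h.isL2Generator_inner k)
  have e : ∀ x, ⟪leftEigenvector V k, x⟫ * (-n k * ⟪leftEigenvector V k, x⟫) =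
      -n k * ⟪leftEigenvector V k, x⟫ ^ 2 := fun x => by ring
  simp_rw [e] at h1
  rw [integral_inner_stationary, integral_const_mul] at h1
  simp only [sub_zero, neg_mul, neg_neg] at h1
  exact le_of_mul_le_mul_right h1 hpos

end IsDiagonalization

/-! ### Small-time increments and the Poincaré inequality for Lipschitz functions -/

/-- The carré du champ `∑ R_{k,l} ∂_k f ∂_l g`. -/
noncomputable def carreDuChamp {r : ℕ} (R : Matrix (Fin r) (Fin r) ℝ) (f g : State r → ℝ)
    (x : State r) : ℝ :=
  ∑ k, ∑ l, R k l * (partialDeriv k f x * partialDeriv l g x)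

lemma fderiv_apply_eq_sum {r : ℕ} (f : State r → ℝ) (x w : State r) :
    fderiv ℝ f x w = ∑ k, w.ofLp k * partialDeriv k f x := by
  have : w = ∑ k, w.ofLp k • EuclideanSpace.single k (1 : ℝ) := by
    ext i
    simp [Finset.sum_apply, Pi.single_apply]
  conv_lhs => rw [this]
  simp [partialDeriv]

lemma map_stdGaussian_toEuclideanCLM {r : ℕ} (B : Matrix (Fin r) (Fin r) ℝ) :
    (stdGaussian (State r)).map (toEuclideanCLM (𝕜 := ℝ) B) =
      multivariateGaussian 0 (B * Bᵀ) := by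
  have hp : (B * Bᵀ).PosSemidef := by
    have := posSemidef_self_mul_conjTranspose B
    rwa [conjTranspose_eq_transpose_of_trivial] at this
  apply Measure.ext_of_charFun
  ext a
  rw [charFun_map_toEuclideanCLM, charFun_multivariateGaussian hp, ← multivariateGaussian_zero_one,
    charFun_multivariateGaussian PosSemidef.one, one_mulVec, ofLp_toEuclideanCLM, ← mulVec_mulVec,
    dotProduct_mulVec _ B, ← mulVec_transpose]
  simp

/-- The carré du champ is the variance of the derivative in a random direction Vz; this recognizes
the small-time limit. -/
lemma integral_sq_fderiv_stdGaussian {r : ℕ} (V : Matrix (Fin r) (Fin r) ℝ) (f : State r → ℝ)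
    (x : State r) :
    ∫ z, (fderiv ℝ f x (toEuclideanCLM (𝕜 := ℝ) V z)) ^ 2 ∂(stdGaussian (State r)) =
      carreDuChamp (V * Vᵀ) f f x := by
  set p : Fin r → ℝ := fun k => partialDeriv k f x with hp
  have h1 : ∀ z : State r, fderiv ℝ f x (toEuclideanCLM (𝕜 := ℝ) V z) =
      ⟪WithLp.toLp 2 (Vᵀ *ᵥ p), z⟫ := by
    intro z
    rw [fderiv_apply_eq_sum, EuclideanSpace.inner_eq_star_dotProduct, ofLp_toEuclideanCLM]
    change (V *ᵥ z.ofLp) ⬝ᵥ p = _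
    rw [star_trivial, mulVec_transpose, dotProduct_comm, dotProduct_mulVec, dotProduct_comm]
  simp_rw [h1]
  rw [← multivariateGaussian_zero_one, integral_sq_inner PosSemidef.one, one_mulVec]
  change (Vᵀ *ᵥ p) ⬝ᵥ (Vᵀ *ᵥ p) = _
  rw [mulVec_transpose V p, ← dotProduct_mulVec, ← mulVec_transpose, mulVec_mulVec]
  simp only [carreDuChamp, dotProduct, mulVec, Finset.mul_sum]
  exact Finset.sum_congr rfl fun _ _ => Finset.sum_congr rfl fun _ _ => by simp only [hp]; ring

/-- Small-time limit of the mean square increment. -/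
lemma tendsto_integral_sq_increment {E : Type*} [NormedAddCommGroup E] [NormedSpace ℝ E]
    [MeasurableSpace E] [BorelSpace E] [SecondCountableTopology E] {η ν : Measure E}
    [IsProbabilityMeasure η] [IsProbabilityMeasure ν] (hη : MemLp id 2 η) (hν : MemLp id 2 ν)
    {f : E → ℝ} (hf : Differentiable ℝ f) {L : NNReal} (hL : LipschitzWith L f)
    {G B : ℝ → E →L[ℝ] E} {V : E →L[ℝ] E}
    (hG : Tendsto (fun t : ℝ => (Real.sqrt t)⁻¹ • (G t - 1)) (𝓝[>] 0) (𝓝 0))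
    (hB : Tendsto (fun t : ℝ => (Real.sqrt t)⁻¹ • B t) (𝓝[>] 0) (𝓝 V)) :
    Tendsto (fun t : ℝ => ∫ p, (f (G t p.1 + B t p.2) - f p.1) ^ 2 / t ∂(η.prod ν)) (𝓝[>] 0)
      (𝓝 (∫ p, (fderiv ℝ f p.1 (V p.2)) ^ 2 ∂(η.prod ν))) := by
  have hsq : Tendsto (fun t : ℝ => Real.sqrt t) (𝓝[>] 0) (𝓝 0) := by
    have := (Real.continuous_sqrt.tendsto 0).mono_left (nhdsWithin_le_nhds (s := Ioi 0))
    simpa using this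
  -- The Lipschitz bound on f, with t^{-1/2}(G_t − 1) eventually of norm below 1 and t^{-1/2}B_t
  -- below ‖V‖ + 1, dominates the quotient by this square.
  have hdom : Integrable (fun p : E × E => ((L : ℝ) * (‖p.1‖ + (‖V‖ + 1) * ‖p.2‖)) ^ 2)
      (η.prod ν) := by
    have h1 : MemLp (fun p : E × E => ‖p.1‖) 2 (η.prod ν) := (hη.comp_fst ν).norm
    have h2 : MemLp (fun p : E × E => ‖p.2‖) 2 (η.prod ν) := (hν.comp_snd η).norm
    exact ((h1.add (h2.const_mul (‖V‖ + 1))).const_mul (L : ℝ)).integrable_sq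
  refine tendsto_integral_filter_of_dominated_convergence _ ?_ ?_ hdom ?_
  · refine Eventually.of_forall fun t => Measurable.aestronglyMeasurable ?_
    have := hf.continuous
    exact Continuous.measurable (by fun_prop)
  · have e1 : ∀ᶠ t : ℝ in 𝓝[>] 0, ‖(Real.sqrt t)⁻¹ • (G t - 1)‖ < 1 :=
      (tendsto_order.1 (by simpa using hG.norm)).2 1 one_pos
    have e2 : ∀ᶠ t : ℝ in 𝓝[>] 0, ‖(Real.sqrt t)⁻¹ • B t‖ < ‖V‖ + 1 :=
      (tendsto_order.1 hB.norm).2 _ (by linarith)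
    filter_upwards [e1, e2, self_mem_nhdsWithin] with t h1 h2 ht
    have ht' : 0 < t := ht
    refine ae_of_all _ fun p => ?_
    have hs : 0 < Real.sqrt t := Real.sqrt_pos.2 ht'
    rw [Real.norm_of_nonneg (by positivity)]
    have h3 : |f (G t p.1 + B t p.2) - f p.1| ≤
        Real.sqrt t * (L * (‖p.1‖ + (‖V‖ + 1) * ‖p.2‖)) := by
      have h4 := hL.dist_le_mul (G t p.1 + B t p.2) p.1
      rw [Real.dist_eq, dist_eq_norm] at h4
      have h5 : G t p.1 + B t p.2 - p.1 = Real.sqrt t •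
          (((Real.sqrt t)⁻¹ • (G t - 1)) p.1 + ((Real.sqrt t)⁻¹ • B t) p.2) := by
        simp only [smul_add, _root_.smul_apply, smul_smul, mul_inv_cancel₀ hs.ne', one_smul,
          _root_.sub_apply, one_apply_eq_self]
        abel
      rw [h5, norm_smul, Real.norm_of_nonneg hs.le] at h4
      refine h4.trans ?_
      rw [mul_left_comm]
      gcongr
      refine (norm_add_le _ _).trans (add_le_add ?_ ?_)
      · exact (ContinuousLinearMap.le_opNorm _ _).trans
          (mul_le_of_le_one_left (norm_nonneg _) h1.le)
      · exact (ContinuousLinearMap.le_opNorm _ _).trans (by gcongr)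
    rw [div_le_iff₀ ht', ← sq_abs]
    calc _ ≤ (Real.sqrt t * (L * (‖p.1‖ + (‖V‖ + 1) * ‖p.2‖))) ^ 2 := by gcongr
      _ = _ := by rw [mul_pow, Real.sq_sqrt ht'.le, mul_comm]
  · refine ae_of_all _ fun p => ?_
    have hd : Tendsto (fun t : ℝ => (Real.sqrt t)⁻¹ • (G t p.1 + B t p.2 - p.1)) (𝓝[>] 0)
        (𝓝 (V p.2)) := by
      have h1 : Tendsto (fun t : ℝ => ((Real.sqrt t)⁻¹ • (G t - 1)) p.1) (𝓝[>] 0) (𝓝 0) := by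
        simpa [Function.comp_def] using
          ((ContinuousLinearMap.apply ℝ E p.1).continuous.tendsto 0).comp hG
      have h2 : Tendsto (fun t : ℝ => ((Real.sqrt t)⁻¹ • B t) p.2) (𝓝[>] 0) (𝓝 (V p.2)) :=
        ((ContinuousLinearMap.apply ℝ E p.2).continuous.tendsto V).comp hB
      have := h1.add h2
      rw [zero_add] at this
      refine this.congr fun t => ?_
      simp only [_root_.smul_apply, _root_.sub_apply, one_apply_eq_self, ← smul_add]
      congr 1
      abel
    have hd0 : Tendsto (fun t : ℝ => G t p.1 + B t p.2 - p.1) (𝓝[>] 0) (𝓝 0) := by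
      have := hsq.smul hd
      rw [zero_smul] at this
      refine this.congr' ?_
      filter_upwards [self_mem_nhdsWithin] with t ht
      rw [smul_smul, mul_inv_cancel₀ (Real.sqrt_pos.2 ht).ne', one_smul]
    -- Differentiability along the displacement, rescaled by t^{-1/2}: the drift part is o(√t), so
    -- only the noise direction V z survives.
    have hlim := ((hf p.1).hasFDerivAt.hasFDerivWithinAt (s := univ)).lim hd0
      (Eventually.of_forall fun _ => mem_univ _) hd
    refine (hlim.pow 2).congr' ?_
    filter_upwards [self_mem_nhdsWithin] with t ht
    have ht' : 0 < t := ht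
    rw [add_sub_cancel, smul_eq_mul, mul_pow, inv_pow, Real.sq_sqrt ht'.le]
    ring

namespace IsDiagonalization
variable {r : ℕ} {F R V : Matrix (Fin r) (Fin r) ℝ} {n : Fin r → ℝ} {f : State r → ℝ}

/-- A square root of the transition covariance. -/
noncomputable def _root_.GroundState.noiseMatrix (V : Matrix (Fin r) (Fin r) ℝ) (n : Fin r → ℝ)
    (t : ℝ) : Matrix (Fin r) (Fin r) ℝ :=
  V * diagonal fun k => Real.sqrt ((1 - Real.exp (-2 * t * n k)) / (2 * n k))

lemma noiseMatrix_mul_transpose (h : IsDiagonalization F R V n) {t : ℝ} (ht : 0 ≤ t) :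
    noiseMatrix V n t * (noiseMatrix V n t)ᵀ = transitionCov F R t := by
  rw [h.transitionCov_eq, noiseMatrix, transpose_mul, diagonal_transpose, ← Matrix.mul_assoc,
    Matrix.mul_assoc V, diagonal_mul_diagonal]
  congr 3
  ext k
  have := h.pos k
  have h1 : Real.exp (-2 * t * n k) ≤ 1 :=
    Real.exp_le_one_iff.2 (by nlinarith [mul_nonneg ht this.le])
  exact Real.mul_self_sqrt (div_nonneg (by linarith) (by linarith))

/-- Linearity in the diagonal reduces the operator limits below to limits of scalar entries. -/
lemma continuous_toEuclideanCLM_diagonal (V W : Matrix (Fin r) (Fin r) ℝ) :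
    Continuous fun d : Fin r → ℝ => toEuclideanCLM (𝕜 := ℝ) (V * diagonal d * W) := by
  let T : (Fin r → ℝ) →ₗ[ℝ] (State r →L[ℝ] State r) :=
    { toFun := fun d => toEuclideanCLM (𝕜 := ℝ) (V * diagonal d * W)
      map_add' := fun d e => by
        rw [← map_add, ← Matrix.add_mul, ← Matrix.mul_add, diagonal_add]; rfl
      map_smul' := fun c d => by
        rw [RingHom.id_apply, ← map_smul, ← Matrix.smul_mul, ← Matrix.mul_smul, ← diagonal_smul] }
  exact T.continuous_of_finiteDimensional

lemma tendsto_drift_increment (h : IsDiagonalization F R V n) :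
    Tendsto (fun t : ℝ => (Real.sqrt t)⁻¹ •
      (toEuclideanCLM (𝕜 := ℝ) (NormedSpace.exp (t • F)) - 1)) (𝓝[>] 0) (𝓝 0) := by
  have hd : Tendsto (fun (t : ℝ) (k : Fin r) =>
      Real.sqrt t * ((Real.exp (-t * n k) - 1) / t)) (𝓝[>] 0) (𝓝 0) := by
    refine tendsto_pi_nhds.2 fun k => ?_
    have h1 := (Real.continuous_sqrt.tendsto 0).mono_left (nhdsWithin_le_nhds (s := Ioi 0))
    simpa using h1.mul (tendsto_slope_exp (n k))
  have h2 := ((continuous_toEuclideanCLM_diagonal V V⁻¹).tendsto 0).comp hd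
  have h0 : toEuclideanCLM (𝕜 := ℝ) (V * diagonal (0 : Fin r → ℝ) * V⁻¹) = 0 := by simp
  rw [h0] at h2
  refine h2.congr' ?_
  filter_upwards [self_mem_nhdsWithin] with t ht
  have ht' : 0 < t := ht
  have hs : 0 < Real.sqrt t := Real.sqrt_pos.2 ht'
  have e : (fun k => Real.sqrt t * ((Real.exp (-t * n k) - 1) / t)) =
      (Real.sqrt t)⁻¹ • ((fun k => Real.exp (-t * n k)) - fun _ => (1 : ℝ)) := by
    ext k
    simp only [Pi.smul_apply, Pi.sub_apply, smul_eq_mul]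
    have := Real.mul_self_sqrt ht'.le
    field_simp
    rw [sq, this]
  have e1 : (1 : State r →L[ℝ] State r) = toEuclideanCLM (𝕜 := ℝ)
      (V * Matrix.diagonal (fun _ => (1 : ℝ)) * V⁻¹) := by
    rw [diagonal_one, Matrix.mul_one, h.mul_inv, map_one]
  rw [Function.comp_apply, e, h.exp_smul_drift, e1, ← map_sub, ← map_smul, ← Matrix.sub_mul,
    ← Matrix.mul_sub, diagonal_sub, diagonal_smul, Matrix.mul_smul, Matrix.smul_mul]
  rfl

/-- Each variance (1 − e^{-2tn})/(2n) is equivalent to t, so the diagonal roots divided by √t tend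
to 1 and only V remains. -/
lemma tendsto_noise_increment (h : IsDiagonalization F R V n) :
    Tendsto (fun t : ℝ => (Real.sqrt t)⁻¹ • toEuclideanCLM (𝕜 := ℝ) (noiseMatrix V n t))
      (𝓝[>] 0) (𝓝 (toEuclideanCLM (𝕜 := ℝ) V)) := by
  have hd : Tendsto (fun (t : ℝ) (k : Fin r) =>
      Real.sqrt (-((Real.exp (-t * (2 * n k)) - 1) / t) / (2 * n k))) (𝓝[>] 0)
      (𝓝 fun _ => 1) := by
    refine tendsto_pi_nhds.2 fun k => ?_
    have h1 := ((tendsto_slope_exp (2 * n k)).neg.div_const (2 * n k)).sqrt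
    have := h.pos k
    rwa [neg_neg, div_self (by positivity), Real.sqrt_one] at h1
  have h2 := ((continuous_toEuclideanCLM_diagonal V 1).tendsto _).comp hd
  have h0 : toEuclideanCLM (𝕜 := ℝ) (V * Matrix.diagonal (fun _ : Fin r => (1 : ℝ)) * 1) =
      toEuclideanCLM (𝕜 := ℝ) V := by simp
  rw [h0] at h2
  refine h2.congr' ?_
  filter_upwards [self_mem_nhdsWithin] with t ht
  have ht' : 0 < t := ht
  have e : (fun k => Real.sqrt (-((Real.exp (-t * (2 * n k)) - 1) / t) / (2 * n k))) =
      (Real.sqrt t)⁻¹ • fun k => Real.sqrt ((1 - Real.exp (-2 * t * n k)) / (2 * n k)) := by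
    ext k
    have := h.pos k
    simp only [Pi.smul_apply, smul_eq_mul]
    rw [← Real.sqrt_inv, ← Real.sqrt_mul (by positivity)]
    congr 1
    rw [show -t * (2 * n k) = -2 * t * n k by ring]
    field_simp
    ring
  rw [Function.comp_apply, e, noiseMatrix, ← map_smul, diagonal_smul, Matrix.mul_smul,
    Matrix.mul_one]

lemma measurePreserving_noise (h : IsDiagonalization F R V n) {t : ℝ} (ht : 0 ≤ t) :
    MeasurePreserving (fun p : State r × State r =>
        toEuclideanCLM (𝕜 := ℝ) (NormedSpace.exp (t • F)) p.1 +
          toEuclideanCLM (𝕜 := ℝ) (noiseMatrix V n t) p.2)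
      ((stationary F R).prod (stdGaussian (State r))) (stationary F R) := by
  have h1 := h.measurePreserving ht
  have h2 : MeasurePreserving (Prod.map id (toEuclideanCLM (𝕜 := ℝ) (noiseMatrix V n t)))
      ((stationary F R).prod (stdGaussian (State r)))
      ((stationary F R).prod (multivariateGaussian 0 (transitionCov F R t))) := by
    refine (MeasurePreserving.id _).prod ⟨by fun_prop, ?_⟩
    rw [map_stdGaussian_toEuclideanCLM, h.noiseMatrix_mul_transpose ht]
  exact h1.comp h2

lemma semigroup_eq_integral_noise (h : IsDiagonalization F R V n) {t : ℝ} (ht : 0 ≤ t)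
    (hf : Measurable f) (x : State r) :
    semigroup F R t f x = ∫ z, f (toEuclideanCLM (𝕜 := ℝ) (NormedSpace.exp (t • F)) x +
      toEuclideanCLM (𝕜 := ℝ) (noiseMatrix V n t) z) ∂(stdGaussian (State r)) := by
  rw [semigroup_apply, ← h.noiseMatrix_mul_transpose ht, ← map_stdGaussian_toEuclideanCLM,
    integral_map (by fun_prop) ?_]
  exact (hf.comp (measurable_const_add _)).aestronglyMeasurable

/-- Expand the square: by invariance both endpoints have law η, and integrating out the noise in the
cross term gives the semigroup. -/
lemma integral_sq_increment (h : IsDiagonalization F R V n) {t : ℝ} (ht : 0 ≤ t)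
    (hfm : Measurable f) (hf : MemLp f 2 (stationary F R)) :
    ∫ p, (f (toEuclideanCLM (𝕜 := ℝ) (NormedSpace.exp (t • F)) p.1 +
      toEuclideanCLM (𝕜 := ℝ) (noiseMatrix V n t) p.2) - f p.1) ^ 2
        ∂((stationary F R).prod (stdGaussian (State r))) =
      2 * (∫ x, f x ^ 2 ∂(stationary F R) -
        ∫ x, f x * semigroup F R t f x ∂(stationary F R)) := by
  have hT := h.measurePreserving_noise ht
  set η := stationary F R
  set ν := stdGaussian (State r)
  set T := fun p : State r × State r =>
    toEuclideanCLM (𝕜 := ℝ) (NormedSpace.exp (t • F)) p.1 +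
      toEuclideanCLM (𝕜 := ℝ) (noiseMatrix V n t) p.2 with hTdef
  have h1 : MemLp (fun p => f (T p)) 2 (η.prod ν) := hf.comp_measurePreserving hT
  have h2 : MemLp (fun p : State r × State r => f p.1) 2 (η.prod ν) := hf.comp_fst ν
  have e : ∀ p : State r × State r, (f (T p) - f p.1) ^ 2 =
      (f (T p) ^ 2 + f p.1 ^ 2) - 2 * (f p.1 * f (T p)) := fun p => by ring
  have h12 : Integrable (fun p => f p.1 * f (T p)) (η.prod ν) := h2.integrable_mul h1
  have hs : Integrable (fun p => f (T p) ^ 2 + f p.1 ^ 2) (η.prod ν) :=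
    h1.integrable_sq.add h2.integrable_sq
  change ∫ p, (f (T p) - f p.1) ^ 2 ∂(η.prod ν) = _
  simp_rw [e]
  rw [integral_sub hs (h12.const_mul 2), integral_add h1.integrable_sq h2.integrable_sq,
    integral_const_mul, integral_prod _ h12]
  have e1 : ∫ p, f (T p) ^ 2 ∂(η.prod ν) = ∫ x, f x ^ 2 ∂η := by
    have := integral_map (μ := η.prod ν) hT.measurable.aemeasurable (f := fun x => f x ^ 2)
      (by fun_prop)
    rw [← this, hT.map_eq]
  have e2 : ∫ p : State r × State r, f p.1 ^ 2 ∂(η.prod ν) = ∫ x, f x ^ 2 ∂η := by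
    have := integral_fun_fst (μ := η) (ν := ν) (fun x => f x ^ 2)
    simpa using this
  rw [e1, e2]
  simp_rw [integral_const_mul]
  have e3 : ∀ x, ∫ z, f (T (x, z)) ∂ν = semigroup F R t f x := fun x =>
    (h.semigroup_eq_integral_noise ht hfm x).symm
  simp_rw [e3]
  ring

/-- The Poincaré inequality for Lipschitz functions. -/
lemma poincare_lipschitz (h : IsDiagonalization F R V n) {lam : ℝ} (hlam0 : 0 ≤ lam)
    (hlam : ∀ k, lam ≤ n k) (hf : ContDiff ℝ 1 f) {L : NNReal} (hL : LipschitzWith L f)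
    (hf2 : MemLp f 2 (stationary F R)) :
    lam * ∫ x, (f x - ∫ y, f y ∂(stationary F R)) ^ 2 ∂(stationary F R) ≤
      (1 / 2) * ∫ x, carreDuChamp R f f x ∂(stationary F R) := by
  have hη : MemLp id 2 (stationary F R) :=
    IsGaussian.memLp_two_id (μ := multivariateGaussian 0 (limitCov F R))
  have hν : MemLp id 2 (stdGaussian (State r)) := IsGaussian.memLp_two_id
  have hlim := tendsto_integral_sq_increment hη hν (hf.differentiable one_ne_zero) hL
    h.tendsto_drift_increment h.tendsto_noise_increment
  have hint : Integrable (fun p : State r × State r =>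
      (fderiv ℝ f p.1 (toEuclideanCLM (𝕜 := ℝ) V p.2)) ^ 2)
      ((stationary F R).prod (stdGaussian (State r))) := by
    have h2 : MemLp (fun p : State r × State r => ‖p.2‖) 2
        ((stationary F R).prod (stdGaussian (State r))) := (hν.comp_snd _).norm
    refine ((h2.const_mul (L * ‖toEuclideanCLM (𝕜 := ℝ) V‖)).integrable_sq).mono' ?_
      (ae_of_all _ fun p => ?_)
    · have : Continuous (fun x => fderiv ℝ f x) := hf.continuous_fderiv one_ne_zero
      exact Continuous.aestronglyMeasurable (by fun_prop)
    · rw [Real.norm_of_nonneg (by positivity), ← sq_abs]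
      gcongr
      rw [← Real.norm_eq_abs, mul_assoc]
      refine (ContinuousLinearMap.le_opNorm _ _).trans ?_
      gcongr
      · exact norm_fderiv_le_of_lipschitz ℝ hL
      · exact ContinuousLinearMap.le_opNorm _ _
  rw [integral_prod _ hint] at hlim
  simp_rw [integral_sq_fderiv_stdGaussian, ← h.cov] at hlim
  -- The correlation bound makes the mean square increment at least 2(1 − e^{-λt}) times the
  -- variance; after division by t the lower bound tends to 2λ times the variance and the increment
  -- to the integral of Γ(f,f).
  have hlow : ∀ᶠ t : ℝ in 𝓝[>] 0,
      2 * (-((Real.exp (-t * lam) - 1) / t)) *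
        ∫ x, (f x - ∫ y, f y ∂(stationary F R)) ^ 2 ∂(stationary F R) ≤
      ∫ p, (f (toEuclideanCLM (𝕜 := ℝ) (NormedSpace.exp (t • F)) p.1 +
        toEuclideanCLM (𝕜 := ℝ) (noiseMatrix V n t) p.2) - f p.1) ^ 2 / t
        ∂((stationary F R).prod (stdGaussian (State r))) := by
    filter_upwards [self_mem_nhdsWithin] with t ht
    have ht' : 0 < t := ht
    rw [integral_div, h.integral_sq_increment ht'.le hf.continuous.measurable hf2, le_div_iff₀ ht']
    have h1 := h.integral_mul_semigroup_le ht'.le hlam0 hlam hf2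
    have h2 := integral_sub_mean_sq hf2 _ rfl
    have e : 2 * (-((Real.exp (-t * lam) - 1) / t)) *
        (∫ x, (f x - ∫ y, f y ∂(stationary F R)) ^ 2 ∂(stationary F R)) * t =
        2 * (1 - Real.exp (-lam * t)) *
          ∫ x, (f x - ∫ y, f y ∂(stationary F R)) ^ 2 ∂(stationary F R) := by
      rw [show -t * lam = -lam * t by ring]
      field_simp
      ring
    rw [e]
    linarith
  have := le_of_tendsto_of_tendsto (((tendsto_slope_exp lam).neg.const_mul 2).mul_const _) hlim hlow
  linarith

end IsDiagonalization

/-! ### Gaussian integration by parts and the Dirichlet form -/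

/-- Gaussian integration by parts, in disintegrated form: it follows from the invariance of
`μ ⊗ μ` under rotations. -/
lemma integral_fderiv_mul_inner_prod {E : Type*} [NormedAddCommGroup E] [InnerProductSpace ℝ E]
    [MeasurableSpace E] [BorelSpace E] [CompleteSpace E] [SecondCountableTopology E]
    {μ : Measure E} [IsGaussian μ] (hμ : μ[id] = 0) {u : E → ℝ} (hu : ContDiff ℝ 1 u)
    (huc : HasCompactSupport u) (w : E) :
    ∫ p, fderiv ℝ u p.1 p.2 * ⟪w, p.2⟫ ∂(μ.prod μ) = ∫ x, u x * ⟪w, x⟫ ∂μ := by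
  obtain ⟨C, hC⟩ := huc.exists_bound_of_continuous hu.continuous
  obtain ⟨D, hD⟩ := (huc.fderiv ℝ).exists_bound_of_continuous (hu.continuous_fderiv one_ne_zero)
  have hC0 : 0 ≤ C := (norm_nonneg _).trans (hC 0)
  have hD0 : 0 ≤ D := (norm_nonneg _).trans (hD 0)
  have hfc : Continuous (fun x => fderiv ℝ u x) := hu.continuous_fderiv one_ne_zero
  have huc' : Continuous u := hu.continuous
  have hid : MemLp (id : E → E) 2 μ := IsGaussian.memLp_two_id
  have m1 : MemLp (fun p : E × E => ‖p.1‖) 2 (μ.prod μ) := (hid.comp_fst μ).norm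
  have m2 : MemLp (fun p : E × E => ‖p.2‖) 2 (μ.prod μ) := (hid.comp_snd μ).norm
  have m12 : MemLp (fun p : E × E => ‖p.1‖ + ‖p.2‖) 2 (μ.prod μ) := m1.add m2
  -- The rotated pair, with X' = Y and Y' = −X. At θ = 0 the derivative of u(X)⟨w, Y⟩ is Du(x)(y)⟨w,
  -- y⟩ − u(x)⟨w, x⟩.
  let X : ℝ → E × E → E := fun θ p => Real.cos θ • p.1 + Real.sin θ • p.2
  let Y : ℝ → E × E → E := fun θ p => -Real.sin θ • p.1 + Real.cos θ • p.2
  have hX : ∀ θ p, ‖X θ p‖ ≤ ‖p.1‖ + ‖p.2‖ := fun θ p => by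
    refine (norm_add_le _ _).trans (add_le_add ?_ ?_)
    · rw [norm_smul]
      exact mul_le_of_le_one_left (norm_nonneg _) (Real.abs_cos_le_one θ)
    · rw [norm_smul]
      exact mul_le_of_le_one_left (norm_nonneg _) (Real.abs_sin_le_one θ)
  have hY : ∀ θ p, ‖Y θ p‖ ≤ ‖p.1‖ + ‖p.2‖ := fun θ p => by
    refine (norm_add_le _ _).trans (add_le_add ?_ ?_)
    · rw [norm_smul, norm_neg]
      exact mul_le_of_le_one_left (norm_nonneg _) (Real.abs_sin_le_one θ)
    · rw [norm_smul]
      exact mul_le_of_le_one_left (norm_nonneg _) (Real.abs_cos_le_one θ)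
  have hXd : ∀ θ p, HasDerivAt (fun θ => X θ p) (Y θ p) θ := fun θ p =>
    ((Real.hasDerivAt_cos θ).smul_const p.1).add ((Real.hasDerivAt_sin θ).smul_const p.2)
  have hYd : ∀ θ p, HasDerivAt (fun θ => Y θ p) (-X θ p) θ := fun θ p => by
    have := ((Real.hasDerivAt_sin θ).neg.smul_const p.1).add
      ((Real.hasDerivAt_cos θ).smul_const p.2)
    convert! this using 1
    simp only [X, neg_add, neg_smul]
  let Φ : ℝ → E × E → ℝ := fun θ p => u (X θ p) * ⟪w, Y θ p⟫
  let Φ' : ℝ → E × E → ℝ := fun θ p =>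
    fderiv ℝ u (X θ p) (Y θ p) * ⟪w, Y θ p⟫ + u (X θ p) * ⟪w, -X θ p⟫
  -- The product of a centred Gaussian law with itself is rotation invariant, so the integral does
  -- not depend on θ and its derivative vanishes.
  have hconst : ∀ θ, ∫ p, Φ θ p ∂(μ.prod μ) = ∫ p, Φ 0 p ∂(μ.prod μ) := by
    intro θ
    have h1 : Φ θ = fun p => Φ 0 (ContinuousLinearMap.rotation θ p) := by
      ext p
      simp [Φ, X, Y, ContinuousLinearMap.rotation_apply]
    have h2 := integral_map (μ := μ.prod μ) (φ := ContinuousLinearMap.rotation θ) (f := Φ 0)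
      (by fun_prop) (Continuous.aestronglyMeasurable (by fun_prop))
    rw [IsGaussian.map_rotation_eq_self hμ] at h2
    rw [h1, ← h2]
  have hder := (hasDerivAt_integral_of_dominated_loc_of_deriv_le (μ := μ.prod μ) (F := Φ)
    (F' := Φ') (x₀ := 0) (s := univ)
    (bound := fun p => D * ‖w‖ * (‖p.1‖ + ‖p.2‖) ^ 2 + C * ‖w‖ * (‖p.1‖ + ‖p.2‖))
    univ_mem (Eventually.of_forall fun θ => Continuous.aestronglyMeasurable (by fun_prop)) ?_
    (Continuous.aestronglyMeasurable (by fun_prop)) ?_ ?_ ?_).2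
  · have h0 : HasDerivAt (fun θ => ∫ p, Φ θ p ∂(μ.prod μ)) 0 0 := by
      rw [funext hconst]
      exact hasDerivAt_const _ _
    have h1 := hder.unique h0
    have i1 : Integrable (fun p : E × E => fderiv ℝ u p.1 p.2 * ⟪w, p.2⟫) (μ.prod μ) := by
      refine (m2.integrable_sq.const_mul (D * ‖w‖)).mono'
        (Continuous.aestronglyMeasurable (by fun_prop)) (ae_of_all _ fun p => ?_)
      rw [norm_mul]
      calc _ ≤ (D * ‖p.2‖) * (‖w‖ * ‖p.2‖) := by
            gcongr
            · exact (ContinuousLinearMap.le_opNorm _ _).trans (by gcongr; exact hD _)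
            · exact abs_real_inner_le_norm _ _
        _ = _ := by ring
    have i2 : Integrable (fun p : E × E => u p.1 * ⟪w, p.1⟫) (μ.prod μ) := by
      refine ((m1.integrable (by norm_num)).const_mul (C * ‖w‖)).mono'
        (Continuous.aestronglyMeasurable (by fun_prop)) (ae_of_all _ fun p => ?_)
      rw [norm_mul, mul_assoc]
      gcongr
      · exact hC _
      · exact abs_real_inner_le_norm _ _
    have e : ∀ p, Φ' 0 p = fderiv ℝ u p.1 p.2 * ⟪w, p.2⟫ - u p.1 * ⟪w, p.1⟫ := fun p => by
      simp [Φ', X, Y, sub_eq_add_neg]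
    simp_rw [e] at h1
    have h3 := integral_fun_fst (μ := μ) (ν := μ) (fun x => u x * ⟪w, x⟫)
    rw [integral_sub i1 i2, h3] at h1
    simp only [probReal_univ, one_smul] at h1
    linarith
  · refine ((m12.integrable (by norm_num)).const_mul (C * ‖w‖)).mono'
      (Continuous.aestronglyMeasurable (by fun_prop)) (ae_of_all _ fun p => ?_)
    rw [norm_mul, mul_assoc]
    gcongr
    · exact hC _
    · exact (abs_real_inner_le_norm _ _).trans (by gcongr; exact hY 0 p)
  · refine ae_of_all _ fun p θ _ => ?_
    refine (norm_add_le _ _).trans (add_le_add ?_ ?_)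
    · rw [norm_mul]
      calc _ ≤ (D * (‖p.1‖ + ‖p.2‖)) * (‖w‖ * (‖p.1‖ + ‖p.2‖)) := by
            gcongr
            · exact (ContinuousLinearMap.le_opNorm _ _).trans
                (mul_le_mul (hD _) (hY θ p) (norm_nonneg _) hD0)
            · exact (abs_real_inner_le_norm _ _).trans (by gcongr; exact hY θ p)
        _ = _ := by ring
    · rw [norm_mul, mul_assoc]
      gcongr
      · exact hC _
      · exact (abs_real_inner_le_norm _ _).trans (by rw [norm_neg]; gcongr; exact hX θ p)
  · exact (m12.integrable_sq.const_mul _).add ((m12.integrable (by norm_num)).const_mul _)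
  · refine ae_of_all _ fun p θ _ => ?_
    have h1 : HasDerivAt (fun θ => u (X θ p)) (fderiv ℝ u (X θ p) (Y θ p)) θ :=
      ((hu.differentiable one_ne_zero) _).hasFDerivAt.comp_hasDerivAt θ (hXd θ p)
    have h2 : HasDerivAt (fun θ => ⟪w, Y θ p⟫) ⟪w, -X θ p⟫ θ :=
      (innerSL ℝ w).hasFDerivAt.comp_hasDerivAt θ (hYd θ p)
    exact h1.mul h2

section IntegrationByParts
variable {r : ℕ} {P : Matrix (Fin r) (Fin r) ℝ}

lemma integral_inner_mul_inner (hP : P.PosSemidef) (a b : State r) :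
    ∫ x, ⟪a, x⟫ * ⟪b, x⟫ ∂(multivariateGaussian 0 P) = a.ofLp ⬝ᵥ P *ᵥ b.ofLp := by
  rw [← covarianceBilin_multivariateGaussian (μ := 0) hP,
    covarianceBilin_apply_eq_cov IsGaussian.memLp_two_id, covariance_eq_sub]
  · simp [integral_inner_multivariateGaussian]
  · exact IsGaussian.memLp_dual _ (innerSL ℝ a) 2 (by simp)
  · exact IsGaussian.memLp_dual _ (innerSL ℝ b) 2 (by simp)

lemma continuous_partialDeriv {u : State r → ℝ} (hu : ContDiff ℝ 1 u) (k : Fin r) :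
    Continuous (partialDeriv k u) := by
  have : Continuous (fun x => fderiv ℝ u x) := hu.continuous_fderiv one_ne_zero
  unfold partialDeriv
  fun_prop

lemma hasCompactSupport_partialDeriv {u : State r → ℝ} (hu : HasCompactSupport u) (k : Fin r) :
    HasCompactSupport (partialDeriv k u) :=
  (hu.fderiv ℝ).comp_left (g := fun L : State r →L[ℝ] ℝ => L (EuclideanSpace.single k 1)) rfl

/-- Gaussian integration by parts. -/
lemma integral_mul_coord (hP : P.PosSemidef) {u : State r → ℝ} (hu : ContDiff ℝ 1 u)
    (huc : HasCompactSupport u) (l : Fin r) :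
    ∫ x, u x * x.ofLp l ∂(multivariateGaussian 0 P) =
      ∑ j, P l j * ∫ x, partialDeriv j u x ∂(multivariateGaussian 0 P) := by
  have h := integral_fderiv_mul_inner_prod (μ := multivariateGaussian 0 P) (by simp) hu huc
    (EuclideanSpace.single l 1)
  have e0 : ∀ x : State r, ⟪EuclideanSpace.single l (1 : ℝ), x⟫ = x.ofLp l := fun x => by
    rw [EuclideanSpace.inner_single_left]; simp
  have hcoord : ∀ j, MemLp (fun x : State r => x.ofLp j) 2 (multivariateGaussian 0 P) := fun j => by
    have := IsGaussian.memLp_dual (multivariateGaussian 0 P)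
      (innerSL ℝ (EuclideanSpace.single j (1 : ℝ))) 2 (by simp)
    refine this.ae_eq (ae_of_all _ fun x => ?_)
    rw [innerSL_apply_apply, EuclideanSpace.inner_single_left]
    simp
  simp_rw [e0] at h
  rw [← h]
  simp_rw [fderiv_apply_eq_sum, Finset.sum_mul]
  have hint : ∀ j, Integrable (fun p : State r × State r =>
      p.2.ofLp j * partialDeriv j u p.1 * p.2.ofLp l)
      ((multivariateGaussian 0 P).prod (multivariateGaussian 0 P)) := fun j => by
    have h1 : Integrable (partialDeriv j u) (multivariateGaussian 0 P) :=
      (continuous_partialDeriv hu j).integrable_of_hasCompactSupport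
        (hasCompactSupport_partialDeriv huc j)
    have h2 : Integrable (fun x : State r => x.ofLp j * x.ofLp l) (multivariateGaussian 0 P) :=
      (hcoord j).integrable_mul (hcoord l)
    refine (h1.mul_prod h2).congr (ae_of_all _ fun p => ?_)
    ring
  rw [integral_finsetSum _ fun j _ => hint j]
  refine Finset.sum_congr rfl fun j _ => ?_
  have e1 : ∀ p : State r × State r, p.2.ofLp j * partialDeriv j u p.1 * p.2.ofLp l =
      partialDeriv j u p.1 * (p.2.ofLp j * p.2.ofLp l) := fun p => by ring
  simp_rw [e1]
  rw [integral_prod_mul (μ := multivariateGaussian 0 P) (ν := multivariateGaussian 0 P)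
    (partialDeriv j u) (fun x : State r => x.ofLp j * x.ofLp l), mul_comm]
  congr 1
  have := integral_inner_mul_inner hP (EuclideanSpace.single l 1) (EuclideanSpace.single j 1)
  simp_rw [e0, EuclideanSpace.inner_single_left] at this
  simpa [mul_comm, Pi.single_apply] using this

lemma partialDeriv_mul {f g : State r → ℝ} {x : State r} (hf : DifferentiableAt ℝ f x)
    (hg : DifferentiableAt ℝ g x) (k : Fin r) :
    partialDeriv k (fun x => f x * g x) x =
      f x * partialDeriv k g x + g x * partialDeriv k f x := by
  simp only [partialDeriv]
  rw [fderiv_fun_mul hf hg]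
  simp

lemma contDiff_partialDeriv {f : State r → ℝ} (hf : ContDiff ℝ 2 f) (k : Fin r) :
    ContDiff ℝ 1 (partialDeriv k f) := by
  have h1 : ContDiff ℝ 1 (fderiv ℝ f) := hf.fderiv_right (by norm_num)
  exact h1.clm_apply contDiff_const

end IntegrationByParts

/-- The generator is the operator of the Dirichlet form `½ ∫ Γ`. -/
lemma IsDiagonalization.integral_mul_generator {r : ℕ} {F R V : Matrix (Fin r) (Fin r) ℝ}
    {n : Fin r → ℝ} (h : IsDiagonalization F R V n) {f g : State r → ℝ}
    (hf : ContDiff ℝ 2 f) (hg : ContDiff ℝ 1 g) (hgc : HasCompactSupport g) :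
    ∫ x, g x * generator F R f x ∂(stationary F R) =
      -((1 / 2) * ∫ x, carreDuChamp R g f x ∂(stationary F R)) := by
  have hP := h.posDef_limitCov.posSemidef
  have hRT : ∀ i j, R i j = R j i := fun i j => by
    have : Rᵀ = R := by rw [h.cov]; simp
    conv_lhs => rw [← this]
    rfl
  have hFP := h.drift_mul_limitCov
  unfold stationary
  set η := multivariateGaussian 0 (limitCov F R) with hη
  have hdf : ∀ k, ContDiff ℝ 1 (partialDeriv k f) := contDiff_partialDeriv hf
  have hu : ∀ k, ContDiff ℝ 1 (fun x => g x * partialDeriv k f x) := fun k => hg.mul (hdf k)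
  have huc : ∀ k, HasCompactSupport (fun x => g x * partialDeriv k f x) := fun k =>
    hgc.mul_right
  have cint : ∀ {q : State r → ℝ}, Continuous q → HasCompactSupport q → Integrable q η :=
    fun hq hqc => hq.integrable_of_hasCompactSupport hqc
  have cdf : ∀ k, Continuous (partialDeriv k f) := fun k => (hdf k).continuous
  have cddf : ∀ k l, Continuous (partialDeriv k (partialDeriv l f)) := fun k l =>
    continuous_partialDeriv (hdf l) k
  have i1 : ∀ k l, Integrable (fun x => partialDeriv k g x * partialDeriv l f x) η := fun k l =>
    cint ((continuous_partialDeriv hg k).mul (cdf l))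
      (hasCompactSupport_partialDeriv hgc k).mul_right
  have i2 : ∀ k l, Integrable (fun x => g x * partialDeriv k (partialDeriv l f) x) η := fun k l =>
    cint (hg.continuous.mul (cddf k l)) hgc.mul_right
  have i3 : ∀ k (l : Fin r), Integrable (fun x : State r => g x * partialDeriv k f x * x.ofLp l) η :=
    fun k l => cint ((hg.continuous.mul (cdf k)).mul (by fun_prop)) (huc k).mul_right
  -- Integration by parts against the coordinate x_l, applied to g ∂_k f; the cutoff function g
  -- supplies the compact support.
  have hS : ∀ k l, ∫ x, g x * partialDeriv k f x * x.ofLp l ∂η =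
      ∑ j, limitCov F R l j * (∫ x, partialDeriv j g x * partialDeriv k f x ∂η +
        ∫ x, g x * partialDeriv j (partialDeriv k f) x ∂η) := by
    intro k l
    rw [hη, integral_mul_coord hP (hu k) (huc k) l]
    refine Finset.sum_congr rfl fun j _ => ?_
    congr 1
    rw [← hη, ← integral_add (i1 j k) (i2 j k)]
    congr 1
    ext x
    rw [partialDeriv_mul (hg.differentiable one_ne_zero x)
      ((hdf k).differentiable one_ne_zero x)]
    ring
  have e : ∀ x, g x * generator F R f x =
      (∑ k, ∑ l, F k l * (g x * partialDeriv k f x * x.ofLp l)) +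
        (1 / 2) * ∑ k, ∑ l, R k l * (g x * partialDeriv k (partialDeriv l f) x) := by
    intro x
    simp only [generator, mul_add, Finset.mul_sum]
    congr 1 <;> exact Finset.sum_congr rfl fun _ _ => Finset.sum_congr rfl fun _ _ => by ring
  have j1 : ∀ k, Integrable
      (fun x : State r => ∑ l, F k l * (g x * partialDeriv k f x * x.ofLp l)) η := fun k =>
    integrable_finsetSum _ fun l _ => (i3 k l).const_mul _
  have j2 : ∀ k, Integrable
      (fun x : State r => ∑ l, R k l * (g x * partialDeriv k (partialDeriv l f) x)) η := fun k =>
    integrable_finsetSum _ fun l _ => (i2 k l).const_mul _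
  have j3 : Integrable
      (fun x : State r => ∑ k, ∑ l, F k l * (g x * partialDeriv k f x * x.ofLp l)) η :=
    integrable_finsetSum _ fun k _ => j1 k
  have j4 : Integrable (fun x : State r =>
      (1 / 2) * ∑ k, ∑ l, R k l * (g x * partialDeriv k (partialDeriv l f) x)) η :=
    (integrable_finsetSum _ fun k _ => j2 k).const_mul _
  rw [integral_congr_ae (ae_of_all _ e), integral_add j3 j4, integral_const_mul,
    integral_finsetSum _ fun k _ => j1 k, integral_finsetSum _ fun k _ => j2 k]
  have e2 : ∀ x, carreDuChamp R g f x =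
    ∑ k, ∑ l, R k l * (partialDeriv k g x * partialDeriv l f x) := fun x => rfl
  have j5 : ∀ k, Integrable
      (fun x : State r => ∑ l, R k l * (partialDeriv k g x * partialDeriv l f x)) η := fun k =>
    integrable_finsetSum _ fun l _ => (i1 k l).const_mul _
  rw [integral_congr_ae (ae_of_all _ e2), integral_finsetSum _ fun k _ => j5 k]
  -- Summing over l contracts F with P, and FP = −R/2. The drift thus produces −½Γ(g, f) and a
  -- second-order term opposite to the diffusion part.
  have s1 : ∀ k, ∫ x, ∑ l, F k l * (g x * partialDeriv k f x * x.ofLp l) ∂η =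
      ∑ l, -((1 / 2) * R k l) * (∫ x, partialDeriv l g x * partialDeriv k f x ∂η +
        ∫ x, g x * partialDeriv l (partialDeriv k f) x ∂η) := by
    intro k
    rw [integral_finsetSum _ fun l _ => (i3 k l).const_mul _]
    simp_rw [integral_const_mul, hS, Finset.mul_sum]
    rw [Finset.sum_comm]
    refine Finset.sum_congr rfl fun j _ => ?_
    simp_rw [← mul_assoc]
    rw [← Finset.sum_mul]
    congr 1
    have := congrFun (congrFun hFP k) j
    rw [mul_apply] at this
    rw [this]
    simp
  have s2 : ∀ k, ∫ x, ∑ l, R k l * (g x * partialDeriv k (partialDeriv l f) x) ∂η =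
      ∑ l, R k l * ∫ x, g x * partialDeriv k (partialDeriv l f) x ∂η := by
    intro k
    rw [integral_finsetSum _ fun l _ => (i2 k l).const_mul _]
    simp_rw [integral_const_mul]
  have s3 : ∀ k, ∫ x, ∑ l, R k l * (partialDeriv k g x * partialDeriv l f x) ∂η =
      ∑ l, R k l * ∫ x, partialDeriv k g x * partialDeriv l f x ∂η := by
    intro k
    rw [integral_finsetSum _ fun l _ => (i1 k l).const_mul _]
    simp_rw [integral_const_mul]
  simp_rw [s1, s2, s3]
  -- Exchanging the summation indices and using R symmetric aligns the second-order terms, without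
  -- exchanging the partial derivatives.
  rw [Finset.sum_comm]
  simp only [Finset.mul_sum, ← Finset.sum_add_distrib, ← Finset.sum_neg_distrib]
  refine Finset.sum_congr rfl fun k _ => Finset.sum_congr rfl fun l _ => ?_
  rw [hRT l k]
  ring

/-! ### Cutoffs and the Poincaré inequality for C² functions -/

variable {r : ℕ}

lemma continuous_carreDuChamp (R : Matrix (Fin r) (Fin r) ℝ) {f g : State r → ℝ}
    (hf : ContDiff ℝ 1 f) (hg : ContDiff ℝ 1 g) : Continuous (carreDuChamp R f g) := by
  unfold carreDuChamp
  refine continuous_finsetSum _ fun k _ => continuous_finsetSum _ fun l _ => ?_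
  exact continuous_const.mul ((continuous_partialDeriv hf k).mul (continuous_partialDeriv hg l))

lemma hasCompactSupport_carreDuChamp (R : Matrix (Fin r) (Fin r) ℝ) {f : State r → ℝ}
    (hf : HasCompactSupport f) (g : State r → ℝ) : HasCompactSupport (carreDuChamp R f g) := by
  refine HasCompactSupport.mono (hf.fderiv ℝ) fun x hx => ?_
  contrapose! hx
  simp only [Function.mem_support, not_not] at hx ⊢
  simp [carreDuChamp, partialDeriv, hx]

/-- The carré du champ of a truncated function. -/
lemma carreDuChamp_mul_self (R : Matrix (Fin r) (Fin r) ℝ) (hR : ∀ i j, R i j = R j i)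
    {f χ : State r → ℝ} (hf : Differentiable ℝ f) (hχ : Differentiable ℝ χ) (x : State r) :
    carreDuChamp R (fun x => f x * χ x) (fun x => f x * χ x) x =
      carreDuChamp R (fun x => (f x * χ x) * χ x) f x + f x ^ 2 * carreDuChamp R χ χ x := by
  have h1 : ∀ k, partialDeriv k (fun x => f x * χ x) x =
      f x * partialDeriv k χ x + χ x * partialDeriv k f x := partialDeriv_mul (hf x) (hχ x)
  have h2 : ∀ k, partialDeriv k (fun x => (f x * χ x) * χ x) x =
      (f x * χ x) * partialDeriv k χ x +
        χ x * (f x * partialDeriv k χ x + χ x * partialDeriv k f x) := fun k => by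
    rw [partialDeriv_mul ((hf x).fun_mul (hχ x)) (hχ x), h1]
  simp only [carreDuChamp, h1, h2]
  have hsym : ∑ k, ∑ l, R k l * (partialDeriv k χ x * partialDeriv l f x) =
      ∑ k, ∑ l, R k l * (partialDeriv k f x * partialDeriv l χ x) := by
    rw [Finset.sum_comm]
    refine Finset.sum_congr rfl fun k _ => Finset.sum_congr rfl fun l _ => ?_
    rw [hR l k, mul_comm (partialDeriv l χ x)]
  rw [← sub_eq_zero]
  -- The two sides differ by fχ(Γ(f, χ) − Γ(χ, f)), which vanishes by the symmetry of R.
  have : ∑ k, ∑ l, R k l * ((f x * partialDeriv k χ x + χ x * partialDeriv k f x) *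
        (f x * partialDeriv l χ x + χ x * partialDeriv l f x)) -
      (∑ k, ∑ l, R k l * (((f x * χ x) * partialDeriv k χ x +
        χ x * (f x * partialDeriv k χ x + χ x * partialDeriv k f x)) * partialDeriv l f x) +
        f x ^ 2 * ∑ k, ∑ l, R k l * (partialDeriv k χ x * partialDeriv l χ x)) =
      (f x * χ x) * (∑ k, ∑ l, R k l * (partialDeriv k f x * partialDeriv l χ x) -
        ∑ k, ∑ l, R k l * (partialDeriv k χ x * partialDeriv l f x)) := by
    simp only [Finset.mul_sum, mul_sub, ← Finset.sum_add_distrib, ← Finset.sum_sub_distrib]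
    exact Finset.sum_congr rfl fun _ _ => Finset.sum_congr rfl fun _ _ => by ring
  rw [this, hsym]
  ring

/-- Dilated cutoffs. -/
noncomputable def cutoff (r : ℕ) (m : ℕ) (x : State r) : ℝ :=
  (⟨1, 2, one_pos, one_lt_two⟩ : ContDiffBump (0 : State r)) (((m : ℝ) + 1)⁻¹ • x)

lemma contDiff_cutoff (m : ℕ) : ContDiff ℝ 2 (cutoff r m) :=
  (ContDiffBump.contDiff _).comp (contDiff_const_smul _)

lemma hasCompactSupport_cutoff (m : ℕ) : HasCompactSupport (cutoff r m) :=
  (ContDiffBump.hasCompactSupport _).comp_smul (by positivity)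

lemma cutoff_nonneg (m : ℕ) (x : State r) : 0 ≤ cutoff r m x := ContDiffBump.nonneg _

lemma cutoff_le_one (m : ℕ) (x : State r) : cutoff r m x ≤ 1 := ContDiffBump.le_one _

lemma tendsto_cutoff (x : State r) : Tendsto (fun m => cutoff r m x) atTop (𝓝 1) := by
  have h1 : Tendsto (fun m : ℕ => ((m : ℝ) + 1)⁻¹ • x) atTop (𝓝 0) := by
    have := (tendsto_one_div_add_atTop_nhds_zero_nat (𝕜 := ℝ)).smul_const x
    simpa using this
  have h2 := ((ContDiffBump.continuous
    (⟨1, 2, one_pos, one_lt_two⟩ : ContDiffBump (0 : State r))).tendsto 0).comp h1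
  rwa [ContDiffBump.one_of_mem_closedBall _ (by simp)] at h2

/-- Dilation scales the gradient by (m + 1)⁻¹ and the carré du champ by its square; one factor is
enough for the limit. -/
lemma exists_carreDuChamp_cutoff_le (R : Matrix (Fin r) (Fin r) ℝ) :
    ∃ C : ℝ, ∀ m x, |carreDuChamp R (cutoff r m) (cutoff r m) x| ≤ C * (1 / ((m : ℝ) + 1)) := by
  let χ : State r → ℝ := fun x => (⟨1, 2, one_pos, one_lt_two⟩ : ContDiffBump (0 : State r)) x
  have hχd : ContDiff ℝ 1 χ := ContDiffBump.contDiff _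
  obtain ⟨C, hC⟩ := (hasCompactSupport_carreDuChamp R (f := χ)
    (ContDiffBump.hasCompactSupport _) χ).exists_bound_of_continuous
    (continuous_carreDuChamp R hχd hχd)
  refine ⟨C, fun m x => ?_⟩
  have hC0 : 0 ≤ C := (norm_nonneg _).trans (hC 0)
  have h1 : ∀ k, partialDeriv k (cutoff r m) x =
      ((m : ℝ) + 1)⁻¹ * partialDeriv k χ (((m : ℝ) + 1)⁻¹ • x) := fun k => by
    have : cutoff r m = fun x => χ (((m : ℝ) + 1)⁻¹ • x) := rfl
    rw [partialDeriv, this, fderiv_comp_smul]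
    rfl
  have h2 : carreDuChamp R (cutoff r m) (cutoff r m) x =
      (((m : ℝ) + 1)⁻¹ * ((m : ℝ) + 1)⁻¹) * carreDuChamp R χ χ (((m : ℝ) + 1)⁻¹ • x) := by
    simp only [carreDuChamp, h1, Finset.mul_sum]
    exact Finset.sum_congr rfl fun _ _ => Finset.sum_congr rfl fun _ _ => by ring
  have hm : ((m : ℝ) + 1)⁻¹ ≤ 1 := inv_le_one_of_one_le₀ (by linarith [m.cast_nonneg (α := ℝ)])
  have hm0 : 0 ≤ ((m : ℝ) + 1)⁻¹ := by positivity
  rw [h2, abs_mul, abs_of_nonneg (by positivity), one_div, mul_comm C]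
  gcongr
  · exact mul_le_of_le_one_left hm0 hm
  · exact hC _

namespace IsDiagonalization
variable {F R V : Matrix (Fin r) (Fin r) ℝ} {n : Fin r → ℝ} {f : State r → ℝ}

/-- Γ(fχ, fχ) = Γ(fχ², f) + f²Γ(χ, χ), and the first term integrates by parts to the generator
against χ²f. Hence Γ(f, f) itself never has to be integrable. -/
lemma poincare_mul_cutoff (h : IsDiagonalization F R V n) {lam : ℝ} (hlam0 : 0 ≤ lam)
    (hlam : ∀ k, lam ≤ n k) (hf : ContDiff ℝ 2 f) {χ : State r → ℝ} (hχ : ContDiff ℝ 2 χ)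
    (hχc : HasCompactSupport χ) :
    lam * (∫ x, (f x * χ x) ^ 2 ∂(stationary F R) -
        (∫ x, f x * χ x ∂(stationary F R)) ^ 2) ≤
      -∫ x, χ x ^ 2 * (f x * generator F R f x) ∂(stationary F R) +
        (1 / 2) * ∫ x, f x ^ 2 * carreDuChamp R χ χ x ∂(stationary F R) := by
  have hR : ∀ i j, R i j = R j i := fun i j => by
    have : Rᵀ = R := by rw [h.cov]; simp
    conv_lhs => rw [← this]
    rfl
  have hfχ : ContDiff ℝ 2 (fun x => f x * χ x) := hf.mul hχ
  have hfχc : HasCompactSupport (fun x => f x * χ x) := hχc.mul_left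
  have hg : ContDiff ℝ 2 (fun x => (f x * χ x) * χ x) := hfχ.mul hχ
  have hgc : HasCompactSupport (fun x => (f x * χ x) * χ x) := hχc.mul_left
  have h12 : (1 : WithTop ℕ∞) ≤ 2 := by norm_num
  obtain ⟨L, hL⟩ := (hfχ.of_le h12).lipschitzWith_of_hasCompactSupport hfχc one_ne_zero
  have hmem : MemLp (fun x => f x * χ x) 2 (stationary F R) :=
    hfχ.continuous.memLp_of_hasCompactSupport hfχc
  have h1 := h.poincare_lipschitz hlam0 hlam (hfχ.of_le h12) hL hmem
  rw [integral_sub_mean_sq hmem _ rfl] at h1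
  have h2 := h.integral_mul_generator hf (hg.of_le h12) hgc
  have i1 : Integrable (carreDuChamp R (fun x => (f x * χ x) * χ x) f) (stationary F R) :=
    (continuous_carreDuChamp R (hg.of_le h12) (hf.of_le h12)).integrable_of_hasCompactSupport
      (hasCompactSupport_carreDuChamp R hgc f)
  have i2 : Integrable (fun x => f x ^ 2 * carreDuChamp R χ χ x) (stationary F R) :=
    ((hf.continuous.pow 2).mul (continuous_carreDuChamp R (hχ.of_le h12)
      (hχ.of_le h12))).integrable_of_hasCompactSupport
      (hasCompactSupport_carreDuChamp R hχc χ).mul_left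
  have e : ∀ x, carreDuChamp R (fun x => f x * χ x) (fun x => f x * χ x) x =
      carreDuChamp R (fun x => (f x * χ x) * χ x) f x + f x ^ 2 * carreDuChamp R χ χ x :=
    carreDuChamp_mul_self R hR (hf.differentiable two_ne_zero) (hχ.differentiable two_ne_zero)
  simp_rw [e] at h1
  rw [integral_add i1 i2] at h1
  have e3 : ∀ x, (f x * χ x) * χ x * generator F R f x =
      χ x ^ 2 * (f x * generator F R f x) := fun x => by ring
  simp_rw [e3] at h2
  linarith

/-- Dominated convergence along the cutoffs, with dominating functions f², |f| and |f Lf|: exactly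
what the class of functions provides. The cutoff error is of order 1/m times ‖f‖². -/
lemma poincare (h : IsDiagonalization F R V n) {lam : ℝ} (hlam0 : 0 ≤ lam)
    (hlam : ∀ k, lam ≤ n k) : Poincare F R lam := by
  intro f hf hf2 hint
  rw [integral_sub_mean_sq hf2 _ rfl]
  have hc : ∀ m, Continuous (cutoff r m) := fun m => (contDiff_cutoff m).continuous
  have hsq : ∀ m x, cutoff r m x ^ 2 ≤ 1 := fun m x =>
    pow_le_one₀ (cutoff_nonneg m x) (cutoff_le_one m x)
  have l1 : Tendsto (fun m => ∫ x, (f x * cutoff r m x) ^ 2 ∂(stationary F R)) atTop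
      (𝓝 (∫ x, f x ^ 2 ∂(stationary F R))) := by
    refine tendsto_integral_of_dominated_convergence (fun x => f x ^ 2)
      (fun m => ((hf.continuous.mul (hc m)).pow 2).aestronglyMeasurable) hf2.integrable_sq
      (fun m => ae_of_all _ fun x => ?_) (ae_of_all _ fun x => ?_)
    · rw [Real.norm_of_nonneg (by positivity), mul_pow]
      exact mul_le_of_le_one_right (sq_nonneg _) (hsq m x)
    · simpa using ((tendsto_cutoff x).const_mul (f x)).pow 2
  have l2 : Tendsto (fun m => ∫ x, f x * cutoff r m x ∂(stationary F R)) atTop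
      (𝓝 (∫ x, f x ∂(stationary F R))) := by
    refine tendsto_integral_of_dominated_convergence (fun x => |f x|)
      (fun m => (hf.continuous.mul (hc m)).aestronglyMeasurable)
      (hf2.integrable (by norm_num)).abs
      (fun m => ae_of_all _ fun x => ?_) (ae_of_all _ fun x => ?_)
    · rw [norm_mul, Real.norm_of_nonneg (cutoff_nonneg m x)]
      exact mul_le_of_le_one_right (norm_nonneg _) (cutoff_le_one m x)
    · simpa using (tendsto_cutoff x).const_mul (f x)
  have l3 : Tendsto (fun m => ∫ x, cutoff r m x ^ 2 * (f x * generator F R f x)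
      ∂(stationary F R)) atTop (𝓝 (∫ x, f x * generator F R f x ∂(stationary F R))) := by
    refine tendsto_integral_of_dominated_convergence (fun x => |f x * generator F R f x|)
      (fun m => ((hc m).pow 2).aestronglyMeasurable.mul hint.aestronglyMeasurable) hint.abs
      (fun m => ae_of_all _ fun x => ?_) (ae_of_all _ fun x => ?_)
    · rw [norm_mul, Real.norm_of_nonneg (by positivity)]
      exact mul_le_of_le_one_left (norm_nonneg _) (hsq m x)
    · simpa using ((tendsto_cutoff x).pow 2).mul_const (f x * generator F R f x)
  have l4 : Tendsto (fun m => ∫ x, f x ^ 2 * carreDuChamp R (cutoff r m) (cutoff r m) x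
      ∂(stationary F R)) atTop (𝓝 0) := by
    obtain ⟨C, hC⟩ := exists_carreDuChamp_cutoff_le R
    have hb := ((tendsto_one_div_add_atTop_nhds_zero_nat (𝕜 := ℝ)).const_mul C).const_mul
      (∫ x, f x ^ 2 ∂(stationary F R))
    rw [mul_zero, mul_zero] at hb
    refine squeeze_zero_norm (fun m => ?_) hb
    refine (norm_integral_le_of_norm_le (hf2.integrable_sq.mul_const (C * (1 / ((m : ℝ) + 1))))
      (ae_of_all _ fun x => ?_)).trans (le_of_eq (integral_mul_const _ _))
    rw [norm_mul, Real.norm_of_nonneg (sq_nonneg _)]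
    exact mul_le_mul_of_nonneg_left (hC m x) (sq_nonneg _)
  have := le_of_tendsto_of_tendsto' ((l1.sub (l2.pow 2)).const_mul lam)
    (l3.neg.add (l4.const_mul (1 / 2))) fun m =>
      h.poincare_mul_cutoff hlam0 hlam hf (contDiff_cutoff m) (hasCompactSupport_cutoff m)
  simpa using this

end IsDiagonalization

/-! ### Monotonicity in the constant and conclusion -/

lemma ExpDecay.mono {r : ℕ} {F R : Matrix (Fin r) (Fin r) ℝ} {c lam : ℝ} (h : ExpDecay F R lam)
    (hc : c ≤ lam) : ExpDecay F R c := fun f hf t ht =>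
  (h f hf t ht).trans (by
    gcongr)

lemma Poincare.mono {r : ℕ} {F R : Matrix (Fin r) (Fin r) ℝ} {c lam : ℝ} (h : Poincare F R lam)
    (hc : c ≤ lam) : Poincare F R c := fun f hf hf2 hint =>
  (mul_le_mul_of_nonneg_right hc (by positivity)).trans (h f hf hf2 hint)

lemma PoincareL2.mono {r : ℕ} {F R : Matrix (Fin r) (Fin r) ℝ} {c lam : ℝ}
    (h : PoincareL2 F R lam) (hc : c ≤ lam) : PoincareL2 F R c := fun f g hfg =>
  (mul_le_mul_of_nonneg_right hc (by positivity)).trans (h f g hfg)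

end GroundState

theorem mainTheorem8 {r : ℕ} (hr : 1 ≤ r) (A R S : Matrix (Fin r) (Fin r) ℝ)
    (hR : R.PosDef) (hS : S.PosSemidef) (hctrl : GroundState.ControllabilityCondition A R S)
    (hrev : A * R = R * Aᵀ) :
    (∃! Q, GroundState.IsPosRiccatiSolution A R S Q) ∧
    (∃! M, GroundState.IsPosSqrt (A * A + R * S) M) ∧
    ∀ Q M : Matrix (Fin r) (Fin r) ℝ, GroundState.IsPosRiccatiSolution A R S Q →
      GroundState.IsPosSqrt (A * A + R * S) M →
      (∀ i j, IntegrableOn (fun s => GroundState.covIntegrand (A - R * Q) R s i j) (Ioi 0)) ∧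
      (GroundState.limitCov (A - R * Q) R).PosDef ∧
      (GroundState.spectralMatrix (GroundState.limitCov (A - R * Q) R) M).IsHermitian ∧
      (∀ f : GroundState.State r → ℝ, MemLp f 2 (GroundState.stationary (A - R * Q) R) →
        ∀ t : ℝ, 0 ≤ t →
          (∀ᵐ x ∂(GroundState.stationary (A - R * Q) R),
            Integrable f (GroundState.transition (A - R * Q) R t x)) ∧
          MemLp (GroundState.semigroup (A - R * Q) R t f) 2
            (GroundState.stationary (A - R * Q) R)) ∧
      ∃ lam : ℝ, 0 < lam ∧
        IsLeast {l : ℝ | -l ∈ spectrum ℝ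
          (GroundState.spectralMatrix (GroundState.limitCov (A - R * Q) R) M)} lam ∧
        GroundState.ExpDecay (A - R * Q) R lam ∧
        GroundState.Poincare (A - R * Q) R lam ∧
        GroundState.PoincareL2 (A - R * Q) R lam ∧
        ∀ c : ℝ,
          (GroundState.ExpDecay (A - R * Q) R c ↔ GroundState.Poincare (A - R * Q) R c) ∧
          (GroundState.ExpDecay (A - R * Q) R c ↔ GroundState.PoincareL2 (A - R * Q) R c) := by
  obtain ⟨Q₀, V, n, hQ₀, hQuniq, h, hFF⟩ :=
    GroundState.exists_diagonalization hR hS hctrl hrev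
  have hsqrt := h.isPosSqrt
  have hMuniq := fun M => h.eq_neg_drift_of_isPosSqrt (M := M)
  rw [hFF] at hsqrt
  simp only [hFF] at hMuniq
  refine ⟨⟨Q₀, hQ₀, hQuniq⟩, ⟨_, hsqrt, hMuniq⟩, fun Q M hQ hM => ?_⟩
  rw [hQuniq Q hQ, hMuniq M hM]
  have : Nonempty (Fin r) := ⟨⟨0, hr⟩⟩
  -- The slowest mode, which exists since r ≥ 1. Its rate is λ; its linear eigenfunction shows that
  -- any admissible constant is at most n k, and monotonicity gives the converse.
  obtain ⟨k, hk⟩ := Finite.exists_min n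
  have hE := h.expDecay (h.pos k).le hk
  have hP := h.poincare (h.pos k).le hk
  have hP2 := h.poincareL2 (h.pos k).le hk
  refine ⟨h.integrableOn_covIntegrand, h.posDef_limitCov, h.isHermitian_spectralMatrix,
    fun f hf t ht => ⟨h.ae_integrable_transition ht hf, h.memLp_semigroup ht hf⟩,
    n k, h.pos k, ?_, hE, hP, hP2, fun c =>
      ⟨⟨fun hc => hP.mono (h.le_of_expDecay hc k), fun hc => hE.mono (h.le_of_poincare hc k)⟩,
        ⟨fun hc => hP2.mono (h.le_of_expDecay hc k),
          fun hc => hE.mono (h.le_of_poincareL2 hc k)⟩⟩⟩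
  rw [h.setOf_neg_mem_spectrum_spectralMatrix]
  exact ⟨⟨k, rfl⟩, fun _ ⟨j, hj⟩ => hj ▸ hk j⟩
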